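/- **Setting.** Let $1\le p\le 2$, let $\|\cdot\|=\|\cdot\|_p$ on $\mathbb R^d$ with conjugate norm $\|\cdot\|_*$, and let $\mathcal X\subset\mathbb R^d$ be nonempty, convex and compact. Let $\omega$ be $1$-strongly convex on $\mathcal X$ with respect to $\|\cdot\|$, with a continuous selection $\omega'(x)\in\partial\omega(x)$, $x\in\mathcal X$. Put $$V(x,y)=\omega(y)-\omega(x)-\langle\omega'(x),y-x\rangle,\qquad D^2=\max_{x,y\in\mathcal X}V(x,y),\qquad P_x(\xi)=\arg\min_{y\in\mathcal X}\{V(x,y)+\langle\xi,y\rangle\}.$$ Let $\pi$ be a probability distribution on a Polish space $\mathsf Z$, $f(x)=\mathbb E_{Z\sim\pi}[F(x,Z)]$ and $f^*=\min_{\mathcal X}f$. Assume: 1. $f$ is differentiable at the points of $\mathcal X$ and $\|\nabla f(x)-\nabla f(y)\|_*\le L\|x-y\|$ for $x,y\in\mathcal X$, with $L>0$; 2. $f$ is convex on $\mathcal X$; 3. $(Z_t)_{t\ge0}$ is a Markov chain on $\mathsf Z$ with a kernel $P$ (and any initial law, for instance $\pi$) that leaves $\pi$ invariant and is uniformly geometrically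 ergodic with mixing time $\tau_{\rm mix}\ge1$: for some constant $C_0$, $|P^t(z_0,A)-\pi(A)|\le C_0(1/2)^{t/\tau_{\rm mix}}$ for all $t>0$, all $z_0\in\mathsf Z$ and all measurable $A$; 4. for all $x\in\mathcal X$ and $z\in\mathsf Z$: $F(\cdot,z)$ is differentiable at $x$, $\mathbb E_\pi[\nabla F(x,Z)]=\nabla f(x)$ and $\|\nabla F(x,z)-\nabla f(x)\|_*^2\le\sigma^2$, where $\sigma\ge0$. **Algorithm (accelerated mirror descent with batching).** Let $J_0,J_1,\dots$ be i.i.d. with $\mathbb P(J_t=j)=2^{-j}$, $j\ge1$, independent of $(Z_t)$. Start from $x^0=x_f^0\in\mathcal X$ and $N_0=0$. For $t=0,1,\dots$ put $$x_g^t=\beta_t^{-1}x^t+(1-\beta_t^{-1})x_f^t,\qquad g^t_j=\frac1{2^jB}\sum_{i=1}^{2^jB}\nabla F(x_g^t,Z_{N_t+i}),$$ and $g^t=g^t_0+2^{J_t}(g^t_{J_t}-g^t_{J_t-1})$ if $2^{J_t}\le M$, $g^t=g^t_0$ otherwise; then $$x^{t+1}=P_{x^t}(\gamma_tg^t),\qquad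 N_{t+1}=N_t+2^{J_t}B,\qquad x_f^{t+1}=\beta_t^{-1}x^{t+1}+(1-\beta_t^{-1})x_f^t.$$ Iteration $t$ makes $2^{J_t}B$ calls of the oracle $\nabla F$ if $2^{J_t}\le M$, and $B$ calls otherwise. **Claim.** For $T\ge1$ run the algorithm with $\beta_t=\frac t2+1$, $\gamma_t=\left(\frac t2+1\right)\min\left\{\frac1{2L},\frac{D}{T^{3/2}\sigma\tau_{\rm mix}^{1/2}}\right\}$ (the second entry being $+\infty$ if $\sigma=0$), $M=T$ and $B=1$. For $\varepsilon>0$ let $$K=\max\left\{\sqrt{\frac{LD^2}{\varepsilon}},\ \frac{\tau_{\rm mix}D^2\sigma^2}{\varepsilon^2}\right\}.$$ There are constants $C_1,C_2>0$ that depend only on $C_0$ such that, with the convention $\log 0=0$ for $d=0$: - (iterations) for every integer $T\ge1$ with $T\ge C_1(1+\log d)^3\,(1+\log(1+K))^2\,K$, one has $\mathbb E[f(x_f^T)-f^*]\le\varepsilon$; - (oracle calls) for the least such $T$, the expected number of oracle calls in the $T$ iterations is at most $C_2(1+\log d)^4\,(1+\log(1+K))^3\,\max\{1,K\}$. In other words,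 an $\varepsilon$-approximate solution takes $\widetilde{\mathcal O}(K)$ iterations and expected oracle calls, where $\widetilde{\mathcal O}$ hides factors that are polynomial in $\log K$ and $\log d$. -/

import Mathlib

open MeasureTheory ProbabilityTheory
open scoped ENNReal

noncomputable section

namespace MAMD

/-! ### The optimization problem -/

section Problem

variable {E S : Type*} [NormedAddCommGroup E] [NormedSpace ℝ E] [MeasurableSpace S]

/-- The objective `f(x) = E_{Z ∼ π}[F(x, Z)]`. -/
def objective (π : Measure S) (F : E → S → ℝ) (x : E) : ℝ := ∫ z, F x z ∂π

/-- The stochastic gradient `∇F(x, z)`, the derivative of `F(·, z)` at `x`. It is a continuous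
linear functional, and its operator norm is the conjugate norm `‖·‖_*`. -/
def stochGrad (F : E → S → ℝ) (x : E) (z : S) : E →L[ℝ] ℝ := fderiv ℝ (fun y => F y z) x

/-- `f` is differentiable at the points of `X` and its gradient is `L`-Lipschitz on `X` from
`‖·‖` to the conjugate norm. -/
def IsSmoothOn (X : Set E) (L : ℝ) (f : E → ℝ) : Prop :=
  (∀ x ∈ X, DifferentiableAt ℝ f x) ∧
    ∀ x ∈ X, ∀ y ∈ X, ‖fderiv ℝ f x - fderiv ℝ f y‖ ≤ L * ‖x - y‖

/-- The stochastic gradient is, at the points of `X`, unbiased under `π` and uniformly within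
distance `σ` (in the conjugate norm) of the gradient of the objective. -/
structure IsBoundedNoiseOracle (X : Set E) (π : Measure S) (F : E → S → ℝ) (σ : ℝ) : Prop where
  integrable : ∀ x, Integrable (F x) π
  differentiable : ∀ x ∈ X, ∀ z, DifferentiableAt ℝ (fun y => F y z) x
  unbiased : ∀ x ∈ X, ∫ z, stochGrad F x z ∂π = fderiv ℝ (objective π F) x
  bounded : ∀ x ∈ X, ∀ z, ‖stochGrad F x z - fderiv ℝ (objective π F) x‖ ^ 2 ≤ σ ^ 2

/-- `ω` is a distance generating function on `X`: it is `1`-strongly convex on `X` with respect to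
the norm of `E`, and `ω'` is a continuous selection of its subgradients on `X`. (The subgradient
inequality makes `ω` lower semicontinuous on `X`.) -/
structure IsDistanceGenerating (X : Set E) (ω : E → ℝ) (ω' : E → E →L[ℝ] ℝ) : Prop where
  strongConvex : StrongConvexOn X 1 ω
  subgradient : ∀ x ∈ X, ∀ y ∈ X, ω x + ω' x (y - x) ≤ ω y
  continuousOn : ContinuousOn ω' X

/-- The Bregman divergence `V(x, y) = ω(y) - ω(x) - ⟨ω'(x), y - x⟩`. -/
def bregman (ω : E → ℝ) (ω' : E → E →L[ℝ] ℝ) (x y : E) : ℝ := ω y - ω x - ω' x (y - x)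

/-- The prox mapping `P_x(ξ) = argmin_{y ∈ X} (V(x, y) + ⟨ξ, y⟩)`. -/
def prox (X : Set E) (ω : E → ℝ) (ω' : E → E →L[ℝ] ℝ) (x : E) (ξ : E →L[ℝ] ℝ) : E :=
  Classical.epsilon fun y => y ∈ X ∧ ∀ u ∈ X, bregman ω ω' x y + ξ y ≤ bregman ω ω' x u + ξ u

end Problem

/-! ### The noise -/

section Noise

variable {Ω S : Type*} [MeasurableSpace Ω] [MeasurableSpace S]

/-- `π` is invariant for the Markov kernel `P` and `P` is uniformly geometrically ergodic with
mixing time `τ`: `P^t(z₀, ·)` is within `C₀ (1/2)^{t/τ}` of `π`, uniformly over all starting points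
`z₀` and all events. (This bound makes `π` the only invariant distribution.) -/
structure IsUniformlyErgodic (P : Kernel S S) (π : Measure S) (C₀ τ : ℝ) : Prop where
  invariant : P.Invariant π
  mixing : ∀ t : ℕ, 0 < t → ∀ z₀ : S, ∀ A : Set S, MeasurableSet A →
    |((P ^ t) z₀).real A - π.real A| ≤ C₀ * (1 / 2 : ℝ) ^ ((t : ℝ) / τ)

/-- `Z` is a time-homogeneous Markov chain with transition kernel `P` on the probability space
`(Ω, μ)` (with an arbitrary initial distribution). -/
structure IsMarkovChain (μ : Measure Ω) (P : Kernel S S) (Z : ℕ → Ω → S) : Prop where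
  measurable : ∀ t, Measurable (Z t)
  markov : ∀ t, ∀ A : Set S, MeasurableSet A →
    μ[(Z (t + 1) ⁻¹' A).indicator (fun _ => (1 : ℝ)) |
        ⨆ s ≤ t, MeasurableSpace.comap (Z s) inferInstance]
      =ᵐ[μ] fun ω => (P (Z t ω)).real A

/-- `J₀, J₁, …` are independent with the geometric law of parameter `1/2` on `{1, 2, …}`. -/
structure IsIIDGeometricHalf (μ : Measure Ω) (J : ℕ → Ω → ℕ) : Prop where
  measurable : ∀ t, Measurable (J t)
  indep : iIndepFun J μ
  law : ∀ t j, 1 ≤ j → μ.real {ω | J t ω = j} = (1 / 2 : ℝ) ^ j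

end Noise

/-! ### The algorithm -/

section Algorithm

variable {E S : Type*} [NormedAddCommGroup E] [NormedSpace ℝ E]

/-- The iterates `x^t`, `x_f^t` and the number `N_t` of consumed samples. -/
structure State (E : Type*) where
  x : E
  xf : E
  N : ℕ

/-- `x_g^t = β⁻¹ x^t + (1 - β⁻¹) x_f^t`. -/
def State.xg (s : State E) (β : ℝ) : E := β⁻¹ • s.x + (1 - β⁻¹) • s.xf

/-- The batched gradient `g_j = 2^{-j} B^{-1} ∑_{i=1}^{2^j B} ∇F(x, Z_{N+i})`. -/
def batchGrad (F : E → S → ℝ) (B : ℕ) (Z : ℕ → S) (x : E) (N j : ℕ) : E →L[ℝ] ℝ :=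
  ((2 : ℝ) ^ j * (B : ℝ))⁻¹ • ∑ i ∈ Finset.Icc 1 (2 ^ j * B), fderiv ℝ (fun y => F y (Z (N + i))) x

/-- The gradient estimator: `g_0 + 2^J (g_J - g_{J-1})` if `2^J ≤ M`, and `g_0` otherwise. -/
def gradEstimator (F : E → S → ℝ) (M B : ℕ) (Z : ℕ → S) (x : E) (N J : ℕ) : E →L[ℝ] ℝ :=
  batchGrad F B Z x N 0 +
    if 2 ^ J ≤ M then (2 : ℝ) ^ J • (batchGrad F B Z x N J - batchGrad F B Z x N (J - 1)) else 0

/-- The state before iteration `t` of Markovian Accelerated Mirror Descent with batching, run from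
`x₀` on the samples `Z` and the batch-size exponents `J`. -/
def run (X : Set E) (ω : E → ℝ) (ω' : E → E →L[ℝ] ℝ) (F : E → S → ℝ) (β γ : ℕ → ℝ) (M B : ℕ)
    (x₀ : E) (Z : ℕ → S) (J : ℕ → ℕ) : ℕ → State E
  | 0 => ⟨x₀, x₀, 0⟩
  | t + 1 =>
    let s := run X ω ω' F β γ M B x₀ Z J t
    let x' := prox X ω ω' s.x (γ t • gradEstimator F M B Z (s.xg (β t)) s.N (J t))
    ⟨x', (β t)⁻¹ • x' + (1 - (β t)⁻¹) • s.xf, s.N + 2 ^ J t * B⟩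

/-- The number of calls of the oracle `∇F` in the first `T` iterations: an iteration that has drawn
the exponent `J` evaluates `2^J B` stochastic gradients if `2^J ≤ M`, and `B` otherwise. -/
def oracleCalls (M B : ℕ) (J : ℕ → ℕ) (T : ℕ) : ℕ :=
  ∑ t ∈ Finset.range T, if 2 ^ J t ≤ M then 2 ^ J t * B else B

/-- The momentums `β_t = t/2 + 1`. -/
def momentum (t : ℕ) : ℝ := (t : ℝ) / 2 + 1

/-- The stepsizes `γ_t = (t/2 + 1) · min {1/(2L), D/(T^{3/2} σ τ^{1/2})}`, where the second entry
is read as `+∞` if `σ = 0`. -/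
def stepsize (L D σ τ : ℝ) (T t : ℕ) : ℝ :=
  ((t : ℝ) / 2 + 1) *
    if σ = 0 then 1 / (2 * L)
    else min (1 / (2 * L)) (D / ((T : ℝ) ^ (3 / 2 : ℝ) * σ * τ ^ (1 / 2 : ℝ)))

/-- The output `x_f^T` of the run with `β_t = t/2 + 1`, `γ_t` as in `stepsize`, `M = T`, `B = 1`. -/
def output (X : Set E) (ω : E → ℝ) (ω' : E → E →L[ℝ] ℝ) (F : E → S → ℝ) (L D σ τ : ℝ)
    (x₀ : E) (Z : ℕ → S) (J : ℕ → ℕ) (T : ℕ) : E :=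
  (run X ω ω' F momentum (stepsize L D σ τ T) T 1 x₀ Z J T).xf

/-- The quantity `max {√(L D² / ε), τ D² σ² / ε²}`. -/
def complexity (L D σ τ ε : ℝ) : ℝ :=
  max (Real.sqrt (L * D ^ 2 / ε)) (τ * D ^ 2 * σ ^ 2 / ε ^ 2)

end Algorithm

end MAMD

end

/-! Write u for a minimiser of f on X. One accelerated step along an inexact gradient changes the
potential, a multiple of f(x_f) - f(u) plus V(x, u), by at most two errors: the variance term
γ⟨noise, x - x'⟩ - V(x, x')/2 and the bias term γ⟨noise, u - x⟩ (`accelerated_step`). For β_t = t/2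
+ 1 and γ_t = β_t g the potentials chain together, and after T steps the gap carries a weight of at
least gT²/4 (`run_potential_le`, `integral_gap_le`).

Both errors are controlled by expressions ⟨s, y - x⟩ - V(x, y), where s is a weighted sum v_1 + ...
+ v_n of consecutive centred gradients, hence by the Fenchel conjugate of V(x, ·) at s. Strong
convexity of ω makes its gradient s ↦ P_x(-s) (up to the shift by x) 1-Lipschitz. Adding the samples
one at a time bounds the conjugate by the double sum over l ≤ k of ⟨v_k, w_l⟩, where the increment
w_l is determined by the history up to sample l and ‖w_l‖ ≤ ‖v_l‖ (`apply_sub_bregman_le_conjBound`,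
`conjBound_eq_sum`, `norm_proxStep_le`). For l < k, uniform ergodicity makes v_k almost centred
given that history, so the pair contributes O(c²σ² 2^{-(k-l)/τ}) for weight c; the sum over l costs
a factor τ and the batch costs O(c²σ²nτ) (`integral_conjBound_le`). No moment inequality for sums of
dual vectors is used, so the estimate is dimension-free; the powers of 1 + log d in the claim matter
only through being at least 1.

The random batch length is averaged next. Since 2^j P(J = j) = 1, the correction 2^J (g_J - g_{J-1})
telescopes in expectation: the bias is that of one batch of length 2^⌊log₂ M⌋
(`integral_multilevel_eq`), while variance and oracle cost pick up a bounded amount per level, in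
total O(log M) (`integral_noiseBound_le`, `IsIIDGeometricHalf.integral_oracleCalls_le`). For the
mixing estimate the exponents are frozen first, by independence and Fubini; the random sample index
N_t then becomes deterministic.

With M = T and the prescribed step scale the expected gap is at most 12 LD²/T² + 120 κ(1 + ⌊log₂ T⌋)
Dσ√τ/√T, where κ = 1 + 4|C₀| (`gap_le_of_forall`). Solving for T costs only logarithmic factors
(`rate_le_of_le`). -/

noncomputable section

namespace MAMD

open Filter Topology

/-! ### Geometry of the Bregman divergence and the prox mapping -/

section Geometry

variable {E : Type*} [NormedAddCommGroup E] [NormedSpace ℝ E] {X : Set E} {ω : E → ℝ}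
  {ω' : E → E →L[ℝ] ℝ}

/-- An affine lower bound on `(0, 1)` persists at the left endpoint. -/
theorem le_of_forall_add_mul_le {a b c : ℝ} (h : ∀ s : ℝ, 0 < s → s < 1 → a - s * c ≤ b) :
    a ≤ b := by
  refine le_of_forall_pos_le_add fun e he => ?_
  have hc : 0 < 2 * (|c| + 1) := by positivity
  have hs : 0 < min (1 / 2 : ℝ) (e / (2 * (|c| + 1))) := by positivity
  have h1 := h _ hs (lt_of_le_of_lt (min_le_left _ _) (by norm_num))
  set s := min (1 / 2 : ℝ) (e / (2 * (|c| + 1))) with hsdef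
  have h2 : s * (2 * (|c| + 1)) ≤ e := by
    rw [← le_div_iff₀ hc]; exact min_le_right _ _
  nlinarith [le_abs_self c, abs_nonneg c]

/-- Strong convexity bounds ω from above at (1 - s)x + sy, the subgradient at x bounds it from below
there; dividing by s leaves a factor 1 - s, which disappears as s → 0. -/
theorem IsDistanceGenerating.half_sq_le_bregman (h : IsDistanceGenerating X ω ω') {x y : E}
    (hx : x ∈ X) (hy : y ∈ X) : 1 / 2 * ‖x - y‖ ^ 2 ≤ bregman ω ω' x y := by
  refine le_of_forall_add_mul_le (c := 1 / 2 * ‖x - y‖ ^ 2) fun s hs hs1 => ?_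
  have h1 := h.strongConvex.2 hx hy (sub_nonneg.2 hs1.le) hs.le (sub_add_cancel 1 s)
  have hmem : (1 - s) • x + s • y ∈ X :=
    h.strongConvex.1 hx hy (by linarith) hs.le (by ring)
  have h2 := h.subgradient x hx _ hmem
  have h3 : (1 - s) • x + s • y - x = s • (y - x) := by module
  rw [h3, map_smul] at h2
  simp only [smul_eq_mul] at h1 h2
  unfold bregman
  have h4 : s * (1 / 2 * ‖x - y‖ ^ 2 - s * (1 / 2 * ‖x - y‖ ^ 2))
      ≤ s * (ω y - ω x - ω' x (y - x)) := by nlinarith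
  exact le_of_mul_le_mul_left h4 hs

theorem IsDistanceGenerating.bregman_nonneg (h : IsDistanceGenerating X ω ω') {x y : E}
    (hx : x ∈ X) (hy : y ∈ X) : 0 ≤ bregman ω ω' x y :=
  le_trans (by positivity) (h.half_sq_le_bregman hx hy)

/-- The selected subgradients are strongly monotone. -/
theorem IsDistanceGenerating.sq_le_sub_apply (h : IsDistanceGenerating X ω ω') {x y : E}
    (hx : x ∈ X) (hy : y ∈ X) : ‖x - y‖ ^ 2 ≤ (ω' y - ω' x) (y - x) := by
  have h1 := h.half_sq_le_bregman hx hy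
  have h2 := h.half_sq_le_bregman hy hx
  rw [norm_sub_rev y x] at h2
  have h3 : ω' y (x - y) = - ω' y (y - x) := by rw [← map_neg, neg_sub]
  simp only [bregman, sub_apply] at *
  linarith

/-- Near x the values ω(y) are squeezed between the affine minorant at x and the upper bound that
the minorant at y gives when tested at x. The upper bound tends to ω(x) because ω' is continuous. -/
theorem IsDistanceGenerating.continuousOn_self (h : IsDistanceGenerating X ω ω') :
    ContinuousOn ω X := by
  intro x hx
  have hlow : Tendsto (fun y => ω x + ω' x (y - x)) (𝓝[X] x) (𝓝 (ω x)) := by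
    have : Continuous fun y => ω x + ω' x (y - x) := by fun_prop
    simpa using (this.tendsto x).mono_left nhdsWithin_le_nhds
  have hup : Tendsto (fun y => ω x - ω' y (x - y)) (𝓝[X] x) (𝓝 (ω x)) := by
    have h1 : Tendsto ω' (𝓝[X] x) (𝓝 (ω' x)) := h.continuousOn x hx
    have h2 : Tendsto (fun y => x - y) (𝓝[X] x) (𝓝 (x - x)) :=
      (tendsto_const_nhds.sub tendsto_id).mono_left nhdsWithin_le_nhds
    have h3 := (isBoundedBilinearMap_apply (𝕜 := ℝ) (E := E) (F := ℝ)).continuous.tendsto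
      (ω' x, x - x)
    have h4 := h3.comp (h1.prodMk_nhds h2)
    simpa [Function.comp_def] using tendsto_const_nhds.sub h4
  refine tendsto_of_tendsto_of_tendsto_of_le_of_le' hlow hup ?_ ?_
  · filter_upwards [self_mem_nhdsWithin] with y hy using h.subgradient x hx y hy
  · filter_upwards [self_mem_nhdsWithin] with y hy
    have := h.subgradient y hy x hx
    linarith

theorem prox_spec (h : IsDistanceGenerating X ω ω') (hX : IsCompact X) {x : E} (hx : x ∈ X)
    (ξ : E →L[ℝ] ℝ) : prox X ω ω' x ξ ∈ X ∧
      ∀ u ∈ X, bregman ω ω' x (prox X ω ω' x ξ) + ξ (prox X ω ω' x ξ)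
        ≤ bregman ω ω' x u + ξ u := by
  have hcont : ContinuousOn (fun y => bregman ω ω' x y + ξ y) X := by
    have := h.continuousOn_self
    unfold bregman
    fun_prop
  obtain ⟨y, hy, hmin⟩ := hX.exists_isMinOn ⟨x, hx⟩ hcont
  exact Classical.epsilon_spec (p := fun y => y ∈ X ∧
    ∀ u ∈ X, bregman ω ω' x y + ξ y ≤ bregman ω ω' x u + ξ u) ⟨y, hy, fun u hu => hmin hu⟩

theorem prox_mem (h : IsDistanceGenerating X ω ω') (hX : IsCompact X) {x : E} (hx : x ∈ X)
    (ξ : E →L[ℝ] ℝ) : prox X ω ω' x ξ ∈ X := (prox_spec h hX hx ξ).1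

/-- The first-order optimality condition of the prox mapping. -/
theorem prox_variational (h : IsDistanceGenerating X ω ω') (hX : IsCompact X) {x u : E}
    (hx : x ∈ X) (hu : u ∈ X) (ξ : E →L[ℝ] ℝ) :
    0 ≤ (ξ - ω' x + ω' (prox X ω ω' x ξ)) (u - prox X ω ω' x ξ) := by
  obtain ⟨hy, hmin⟩ := prox_spec h hX hx ξ
  set y := prox X ω ω' x ξ
  have hmem : ∀ s ∈ Set.Ioo (0 : ℝ) 1, y + s • (u - y) ∈ X := fun s hs =>
    h.strongConvex.1.add_smul_sub_mem hy hu ⟨hs.1.le, hs.2.le⟩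
  -- Subgradients at the minimiser need not be unique, and optimality has to hold for the selected
  -- one. Minimality is therefore compared with the subgradient inequality at the nearby point y +
  -- s(u - y), and continuity of ω' carries the sign to s = 0.
  have hpos : ∀ s ∈ Set.Ioo (0 : ℝ) 1, 0 ≤ (ξ - ω' x + ω' (y + s • (u - y))) (u - y) := by
    intro s hs
    have h1 := hmin _ (hmem s hs)
    have h2 := h.subgradient _ (hmem s hs) y hy
    have h3 : y - (y + s • (u - y)) = -(s • (u - y)) := by module
    have h4 : y + s • (u - y) - x = (y - x) + s • (u - y) := by module
    rw [h3] at h2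
    simp only [bregman, h4, map_add, map_neg, map_smul, smul_eq_mul] at h1 h2
    simp only [add_apply, sub_apply]
    refine nonneg_of_mul_nonneg_right (a := s) ?_ hs.1
    linarith
  have hev : ∀ᶠ s in 𝓝[>] (0 : ℝ), s ∈ Set.Ioo (0 : ℝ) 1 :=
    Ioo_mem_nhdsGT (by norm_num)
  have hlim : Tendsto (fun s : ℝ => y + s • (u - y)) (𝓝[>] 0) (𝓝[X] y) := by
    refine tendsto_nhdsWithin_iff.2 ⟨?_, hev.mono hmem⟩
    have : Continuous fun s : ℝ => y + s • (u - y) := by fun_prop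
    simpa using (this.tendsto 0).mono_left nhdsWithin_le_nhds
  have hlim2 : Tendsto (fun s : ℝ => (ξ - ω' x + ω' (y + s • (u - y))) (u - y)) (𝓝[>] 0)
      (𝓝 ((ξ - ω' x + ω' y) (u - y))) := by
    have h1 : Tendsto (fun s : ℝ => ω' (y + s • (u - y))) (𝓝[>] 0) (𝓝 (ω' y)) :=
      (h.continuousOn y hy).tendsto.comp hlim
    exact ((ContinuousLinearMap.apply ℝ ℝ (u - y)).continuous.tendsto _).comp
      (tendsto_const_nhds.add h1)
  exact ge_of_tendsto hlim2 (hev.mono hpos)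

/-- The three-point inequality of mirror descent. -/
theorem prox_three_point (h : IsDistanceGenerating X ω ω') (hX : IsCompact X) {x u : E}
    (hx : x ∈ X) (hu : u ∈ X) (ξ : E →L[ℝ] ℝ) :
    ξ (prox X ω ω' x ξ - u) ≤ bregman ω ω' x u - bregman ω ω' (prox X ω ω' x ξ) u
      - bregman ω ω' x (prox X ω ω' x ξ) := by
  have h1 := prox_variational h hX hx hu ξ
  simp only [bregman, add_apply, sub_apply,
    map_sub] at h1 ⊢
  linarith

/-- Adding the two optimality conditions, each tested at the other minimiser, and using strong
monotonicity of ω'. The prox point thus depends on x and ξ only through ξ - ω'(x), and is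
1-Lipschitz in it. For fixed x this is smoothness of the conjugate; for varying x it yields
measurability. -/
theorem norm_prox_sub_prox_le (h : IsDistanceGenerating X ω ω') (hX : IsCompact X) {x₁ x₂ : E}
    (hx₁ : x₁ ∈ X) (hx₂ : x₂ ∈ X) (ξ₁ ξ₂ : E →L[ℝ] ℝ) :
    ‖prox X ω ω' x₁ ξ₁ - prox X ω ω' x₂ ξ₂‖ ≤ ‖(ξ₁ - ω' x₁) - (ξ₂ - ω' x₂)‖ := by
  have hy₁ := prox_mem h hX hx₁ ξ₁
  have hy₂ := prox_mem h hX hx₂ ξ₂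
  have h1 := prox_variational h hX hx₁ hy₂ ξ₁
  have h2 := prox_variational h hX hx₂ hy₁ ξ₂
  set y₁ := prox X ω ω' x₁ ξ₁
  set y₂ := prox X ω ω' x₂ ξ₂
  have h3 := h.sq_le_sub_apply hy₁ hy₂
  have h4 : (ξ₁ - ω' x₁ - (ξ₂ - ω' x₂)) (y₂ - y₁) ≤
      ‖(ξ₁ - ω' x₁) - (ξ₂ - ω' x₂)‖ * ‖y₁ - y₂‖ := by
    rw [norm_sub_rev y₁ y₂]
    exact (Real.le_norm_self _).trans (ContinuousLinearMap.le_opNorm _ _)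
  have h5 : ‖y₁ - y₂‖ ^ 2 ≤ ‖(ξ₁ - ω' x₁) - (ξ₂ - ω' x₂)‖ * ‖y₁ - y₂‖ := by
    refine le_trans ?_ h4
    simp only [add_apply, sub_apply, map_sub] at h1 h2 h3 ⊢
    linarith
  rcases (norm_nonneg (y₁ - y₂)).eq_or_lt with h0 | h0
  · rw [← h0]; positivity
  · exact le_of_mul_le_mul_right (by nlinarith) h0

theorem prox_zero (h : IsDistanceGenerating X ω ω') (hX : IsCompact X) {x : E} (hx : x ∈ X) :
    prox X ω ω' x 0 = x := by
  have h1 := prox_variational h hX hx hx 0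
  have h2 := h.sq_le_sub_apply hx (prox_mem h hX hx 0)
  have h3 : (0 - ω' x + ω' (prox X ω ω' x 0)) (x - prox X ω ω' x 0)
      = - (ω' (prox X ω ω' x 0) - ω' x) (prox X ω ω' x 0 - x) := by
    simp only [add_apply, sub_apply, map_sub,
      zero_apply]
    ring
  rw [h3] at h1
  have h4 : ‖x - prox X ω ω' x 0‖ ^ 2 = 0 := le_antisymm (by linarith) (by positivity)
  have h5 : x - prox X ω ω' x 0 = 0 := by simpa using h4
  exact (sub_eq_zero.1 h5).symm

/-! ### The Fenchel conjugate of the Bregman divergence along partial sums -/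

/-- The telescoped bound for the conjugate of `V(x, ·)` at the sum of `v 1, …, v n`: the pairing of
every `v k` with the increment of the gradient of the conjugate. -/
def conjBound (X : Set E) (ω : E → ℝ) (ω' : E → E →L[ℝ] ℝ) (x : E) (v : ℕ → E →L[ℝ] ℝ)
    (n : ℕ) : ℝ :=
  ∑ k ∈ Finset.Icc 1 n, v k (prox X ω ω' x (-∑ i ∈ Finset.Icc 1 k, v i) - x)

/-- A be-the-leader induction: y* = P_x(-s) maximises ⟨s, y - x⟩ - V(x, y) for the full sum s, so y
may be replaced by y*. At y* the last summand is exactly the last term of the bound, and the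
induction hypothesis applies to the remaining ones. -/
theorem apply_sub_bregman_le_conjBound (h : IsDistanceGenerating X ω ω') (hX : IsCompact X)
    {x : E} (hx : x ∈ X) (v : ℕ → E →L[ℝ] ℝ) (n : ℕ) {y : E} (hy : y ∈ X) :
    (∑ i ∈ Finset.Icc 1 n, v i) (y - x) - bregman ω ω' x y ≤ conjBound X ω ω' x v n := by
  induction n generalizing y with
  | zero => simpa [conjBound] using h.bregman_nonneg hx hy
  | succ n ih =>
    set u := ∑ i ∈ Finset.Icc 1 (n + 1), v i with hu
    have h1 := (prox_spec h hX hx (-u)).2 y hy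
    have h2 := ih (prox_mem h hX hx (-u))
    have h3 : u = ∑ i ∈ Finset.Icc 1 n, v i + v (n + 1) := by
      rw [hu, Finset.sum_Icc_succ_top (by omega)]
    have h4 : conjBound X ω ω' x v (n + 1) = conjBound X ω ω' x v n
        + v (n + 1) (prox X ω ω' x (-u) - x) := by
      rw [conjBound, Finset.sum_Icc_succ_top (by omega), ← hu]; rfl
    rw [h4]
    have h5 : u (prox X ω ω' x (-u) - x) = (∑ i ∈ Finset.Icc 1 n, v i) (prox X ω ω' x (-u) - x)
        + v (n + 1) (prox X ω ω' x (-u) - x) := by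
      rw [← add_apply, ← h3]
    simp only [neg_apply, map_sub] at h1 h2 h5 ⊢
    linarith

/-- The increments of the gradient of the conjugate of `V(x, ·)` along the partial sums of `v`. -/
def proxStep (X : Set E) (ω : E → ℝ) (ω' : E → E →L[ℝ] ℝ) (x : E) (v : ℕ → E →L[ℝ] ℝ)
    (l : ℕ) : E :=
  prox X ω ω' x (-∑ i ∈ Finset.Icc 1 l, v i) - prox X ω ω' x (-∑ i ∈ Finset.Icc 1 (l - 1), v i)

theorem norm_proxStep_le (h : IsDistanceGenerating X ω ω') (hX : IsCompact X) {x : E}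
    (hx : x ∈ X) (v : ℕ → E →L[ℝ] ℝ) {l : ℕ} (hl : 1 ≤ l) :
    ‖proxStep X ω ω' x v l‖ ≤ ‖v l‖ := by
  obtain ⟨m, rfl⟩ := Nat.exists_eq_add_of_le' hl
  refine (norm_prox_sub_prox_le h hX hx hx _ _).trans (le_of_eq ?_)
  rw [Finset.sum_Icc_succ_top (by omega), ← norm_neg]
  congr 1
  simp only [Nat.add_sub_cancel]
  abel

/-- P_x(-s_k) - x telescopes into increments because P_x(0) = x. The double sum pairs each v_k with
increments known at earlier times l ≤ k, the form in which mixing can be used. -/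
theorem conjBound_eq_sum (h : IsDistanceGenerating X ω ω') (hX : IsCompact X) {x : E}
    (hx : x ∈ X) (v : ℕ → E →L[ℝ] ℝ) (n : ℕ) :
    conjBound X ω ω' x v n =
      ∑ k ∈ Finset.Icc 1 n, ∑ l ∈ Finset.Icc 1 k, v k (proxStep X ω ω' x v l) := by
  refine Finset.sum_congr rfl fun k hk => ?_
  clear hk
  rw [← map_sum]
  congr 1
  induction k with
  | zero => simp [prox_zero h hX hx]
  | succ k ih =>
    rw [Finset.sum_Icc_succ_top (by omega : 1 ≤ k + 1) (fun l => proxStep X ω ω' x v l), ← ih]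
    simp [proxStep]

end Geometry

/-! ### One iteration of accelerated mirror descent -/

section Iteration

variable {E : Type*} [NormedAddCommGroup E] [NormedSpace ℝ E] {X : Set E} {ω : E → ℝ}
  {ω' : E → E →L[ℝ] ℝ} {f : E → ℝ} {L : ℝ}

theorem hasDerivAt_comp_segment {x y : E} {s : ℝ} (hf : DifferentiableAt ℝ f (x + s • (y - x))) :
    HasDerivAt (fun s : ℝ => f (x + s • (y - x))) (fderiv ℝ f (x + s • (y - x)) (y - x)) s := by
  have h1 : HasDerivAt (fun s : ℝ => x + s • (y - x)) (y - x) s := by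
    simpa using ((hasDerivAt_id s).smul_const (y - x)).const_add x
  exact hf.hasFDerivAt.comp_hasDerivAt s h1

/-- The descent lemma on a convex set. -/
theorem IsSmoothOn.le_add_sq (hf : IsSmoothOn X L f) (hX : Convex ℝ X) {x y : E} (hx : x ∈ X)
    (hy : y ∈ X) : f y ≤ f x + fderiv ℝ f x (y - x) + L / 2 * ‖y - x‖ ^ 2 := by
  have hmem : ∀ s ∈ Set.Icc (0 : ℝ) 1, x + s • (y - x) ∈ X := fun s hs =>
    hX.add_smul_sub_mem hx hy hs
  have hderiv : ∀ s ∈ Set.Icc (0 : ℝ) 1, HasDerivAt (fun s : ℝ => f (x + s • (y - x)))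
      (fderiv ℝ f (x + s • (y - x)) (y - x)) s := fun s hs =>
    hasDerivAt_comp_segment (hf.1 _ (hmem s hs))
  have hB : ∀ s : ℝ, HasDerivAt (fun s : ℝ => f x + s * fderiv ℝ f x (y - x)
      + L / 2 * ‖y - x‖ ^ 2 * s ^ 2)
      (fderiv ℝ f x (y - x) + L / 2 * ‖y - x‖ ^ 2 * (2 * s)) s := by
    intro s
    have h1 := ((hasDerivAt_id s).mul_const (fderiv ℝ f x (y - x))).const_add (f x)
    have h2 := (hasDerivAt_pow 2 s).const_mul (L / 2 * ‖y - x‖ ^ 2)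
    exact (h1.add h2).congr_deriv (by norm_num)
  have key := image_le_of_deriv_right_le_deriv_boundary (a := 0) (b := 1)
    (fun s hs => (hderiv s hs).continuousAt.continuousWithinAt)
    (fun s hs => (hderiv s (Set.Ico_subset_Icc_self hs)).hasDerivWithinAt)
    (B := fun s : ℝ => f x + s * fderiv ℝ f x (y - x) + L / 2 * ‖y - x‖ ^ 2 * s ^ 2)
    (by simp) (fun s hs => (hB s).continuousAt.continuousWithinAt)
    (fun s hs => (hB s).hasDerivWithinAt) (fun s hs => ?_)
    (Set.right_mem_Icc.2 zero_le_one)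
  · simpa using key
  · have h1 := hf.2 _ (hmem s (Set.Ico_subset_Icc_self hs)) _ hx
    have h2 : (fderiv ℝ f (x + s • (y - x)) - fderiv ℝ f x) (y - x)
        ≤ ‖fderiv ℝ f (x + s • (y - x)) - fderiv ℝ f x‖ * ‖y - x‖ :=
      (Real.le_norm_self _).trans (ContinuousLinearMap.le_opNorm _ _)
    have h3 : x + s • (y - x) - x = s • (y - x) := by abel
    rw [h3, norm_smul, Real.norm_of_nonneg hs.1] at h1
    have h4 := h2.trans (mul_le_mul_of_nonneg_right h1 (norm_nonneg _))
    rw [sub_apply] at h4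
    linarith

theorem _root_.ConvexOn.add_fderiv_le {f : E → ℝ} (hf : ConvexOn ℝ X f) {x y : E} (hx : x ∈ X)
    (hy : y ∈ X) (hd : DifferentiableAt ℝ f x) : f x + fderiv ℝ f x (y - x) ≤ f y := by
  have h1 : HasDerivAt (fun s : ℝ => f (x + s • (y - x))) (fderiv ℝ f x (y - x)) 0 := by
    simpa using hasDerivAt_comp_segment (x := x) (y := y) (s := 0) (f := f) (by simpa using hd)
  have h2 := h1.hasDerivWithinAt (s := Set.Ioi 0)
  rw [hasDerivWithinAt_iff_tendsto_slope' (by simp)] at h2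
  have h3 : fderiv ℝ f x (y - x) ≤ f y - f x := by
    refine le_of_tendsto h2 ?_
    filter_upwards [Ioo_mem_nhdsGT (zero_lt_one (α := ℝ))] with s hs
    have h4 := hf.2 hx hy (sub_nonneg.2 hs.2.le) hs.1.le (sub_add_cancel 1 s)
    have h5 : (1 - s) • x + s • y = x + s • (y - x) := by module
    rw [h5] at h4
    simp only [smul_eq_mul] at h4
    rw [slope_def_field, sub_zero, div_le_iff₀ hs.1]
    simp only [zero_smul, add_zero]
    linarith
  linarith

/-- The inequality satisfied by one step of accelerated mirror descent along an inexact gradient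
`g`. -/
theorem accelerated_step (h : IsDistanceGenerating X ω ω') (hX : IsCompact X)
    (hf : IsSmoothOn X L f) (hconv : ConvexOn ℝ X f) {β γ : ℝ} (hβ : 1 ≤ β) (hγ : 0 ≤ γ)
    (hγβ : γ * (2 * L) ≤ β) {x xf xs : E} (hx : x ∈ X) (hxf : xf ∈ X) (hxs : xs ∈ X)
    (g : E →L[ℝ] ℝ) {xg x' : E} (hxg : xg = β⁻¹ • x + (1 - β⁻¹) • xf)
    (hx' : x' = prox X ω ω' x (γ • g)) :
    β * γ * (f (β⁻¹ • x' + (1 - β⁻¹) • xf) - f xs) + bregman ω ω' x' xs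
      ≤ (β - 1) * γ * (f xf - f xs) + bregman ω ω' x xs
        + (γ * (g - fderiv ℝ f xg) (x - x') - 1 / 2 * bregman ω ω' x x')
        + γ * (g - fderiv ℝ f xg) (xs - x) := by
  have hXc := h.strongConvex.1
  have hβ0 : 0 < β := by linarith
  have hb1 : 0 ≤ β⁻¹ := by positivity
  have hb2 : 0 ≤ 1 - β⁻¹ := sub_nonneg.2 (inv_le_one_of_one_le₀ hβ)
  have hx'X : x' ∈ X := hx' ▸ prox_mem h hX hx _
  have hxgX : xg ∈ X := hxg ▸ hXc hx hxf hb1 hb2 (by ring)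
  have hxf'X : β⁻¹ • x' + (1 - β⁻¹) • xf ∈ X := hXc hx'X hxf hb1 hb2 (by ring)
  have h1 := hf.le_add_sq hXc hxgX hxf'X
  have h2 : β⁻¹ • x' + (1 - β⁻¹) • xf - xg = β⁻¹ • (x' - x) := by rw [hxg]; module
  have h3 := hconv.add_fderiv_le hxgX hxf (hf.1 _ hxgX)
  have h4 := hconv.add_fderiv_le hxgX hxs (hf.1 _ hxgX)
  have h5 := prox_three_point h hX hx hxs (γ • g)
  rw [← hx'] at h5
  have h6 := h.half_sq_le_bregman hx hx'X
  rw [norm_sub_rev] at h6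
  rw [h2, norm_smul, Real.norm_of_nonneg hb1] at h1
  -- This splitting of the displacement lets convexity be applied from x_g towards x_f (weight β -
  -- 1) and, after the three-point inequality, towards the comparison point (weight 1).
  have hdec : β⁻¹ • (x' - x) = (1 - β⁻¹) • (xf - xg) + β⁻¹ • (x' - xg) := by
    rw [hxg]
    have : β⁻¹ * β = 1 := inv_mul_cancel₀ hβ0.ne'
    module
  rw [hdec] at h1
  set G := fderiv ℝ f xg
  simp only [map_add, map_smul, map_sub, smul_eq_mul, sub_apply, smul_apply] at *
  have e1 : β * γ * β⁻¹ = γ := by field_simp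
  have e2 : β * γ * (1 - β⁻¹) = (β - 1) * γ := by field_simp
  have hβγ : 0 ≤ β * γ := by positivity
  have h1' := mul_le_mul_of_nonneg_left h1 hβγ
  have h3' := mul_le_mul_of_nonneg_left h3 (mul_nonneg (sub_nonneg.2 hβ) hγ)
  have h4' := mul_le_mul_of_nonneg_left h4 hγ
  have e3 : β * γ * (f xg + ((1 - β⁻¹) * (G xf - G xg) + β⁻¹ * (G x' - G xg))
      + L / 2 * (β⁻¹ * ‖x' - x‖) ^ 2) = β * γ * f xg + (β - 1) * γ * (G xf - G xg)
      + γ * (G x' - G xg) + γ * L / (2 * β) * ‖x' - x‖ ^ 2 := by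
    rw [← e2]
    field_simp
    ring
  rw [e3] at h1'
  -- As ‖x' - x‖²/2 ≤ V(x, x'), the smoothness error uses up half of the -V(x, x') from the prox
  -- step; the other half is kept to absorb the noise.
  have h7 : γ * L / (2 * β) ≤ 1 / 4 := by
    rw [div_le_iff₀ (by positivity)]; linarith
  have h8 := mul_le_mul_of_nonneg_right h7 (sq_nonneg ‖x' - x‖)
  linarith

/-! ### The multilevel estimator and its conjugate bound -/

/-- The mean of the first `2 ^ j` terms of `h`. -/
def dyadicMean (h : ℕ → E →L[ℝ] ℝ) (j : ℕ) : E →L[ℝ] ℝ :=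
  ((2 : ℝ) ^ j)⁻¹ • ∑ i ∈ Finset.Icc 1 (2 ^ j), h i

/-- The truncated multilevel estimator built from the dyadic means of `h`. -/
def multilevel (h : ℕ → E →L[ℝ] ℝ) (M J : ℕ) : E →L[ℝ] ℝ :=
  dyadicMean h 0 + if 2 ^ J ≤ M then (2 : ℝ) ^ J • (dyadicMean h J - dyadicMean h (J - 1)) else 0

/-- The bound for the noise of one iteration in terms of the telescoped conjugate. -/
def noiseBound (X : Set E) (ω : E → ℝ) (ω' : E → E →L[ℝ] ℝ) (x : E) (h : ℕ → E →L[ℝ] ℝ) (γ : ℝ)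
    (M J : ℕ) : ℝ :=
  conjBound X ω ω' x (fun i => (-(6 * γ)) • h i) 1
    + if 2 ^ J ≤ M then conjBound X ω ω' x (fun i => (-(6 * γ)) • h i) (2 ^ J)
      + conjBound X ω ω' x (fun i => (12 * γ) • h i) (2 ^ (J - 1)) else 0

/-- The available V(x, x')/2 is divided into three shares of V(x, x')/6, for g_0, g_J and g_{J-1}.
In unnormalised sums 2^J (g_J - g_{J-1}) is the sum of 2^J terms minus twice the sum of 2^{J-1}
terms; factoring out 1/6 gives the weights -6γ, -6γ and 12γ. -/
theorem noise_le_noiseBound (hd : IsDistanceGenerating X ω ω') (hX : IsCompact X) {x x' : E}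
    (hx : x ∈ X) (hx' : x' ∈ X) (h : ℕ → E →L[ℝ] ℝ) (γ : ℝ) (M : ℕ) {J : ℕ} (hJ : 1 ≤ J) :
    γ * multilevel h M J (x - x') - 1 / 2 * bregman ω ω' x x'
      ≤ 1 / 6 * noiseBound X ω ω' x h γ M J := by
  have hV := hd.bregman_nonneg hx hx'
  have h0 := apply_sub_bregman_le_conjBound hd hX hx (fun i => (-(6 * γ)) • h i) 1 hx'
  have h1 := apply_sub_bregman_le_conjBound hd hX hx (fun i => (-(6 * γ)) • h i) (2 ^ J) hx'
  have h2 := apply_sub_bregman_le_conjBound hd hX hx (fun i => (12 * γ) • h i) (2 ^ (J - 1)) hx'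
  obtain ⟨J, rfl⟩ := Nat.exists_eq_add_of_le' hJ
  simp only [Nat.add_sub_cancel] at *
  have e : x - x' = -(x' - x) := by abel
  unfold multilevel noiseBound dyadicMean
  rw [← Finset.smul_sum] at h0 h1 h2
  rw [e]
  split_ifs
  · simp only [map_neg, add_apply, sub_apply, smul_apply, smul_eq_mul, pow_zero, inv_one,
      one_mul, Nat.add_sub_cancel, pow_succ] at *
    have hp : (2 : ℝ) ^ J ≠ 0 := by positivity
    have e1 : ∀ a b : ℝ, (2 : ℝ) ^ J * 2 * ((2 ^ J * 2)⁻¹ * a - (2 ^ J)⁻¹ * b) = a - 2 * b := by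
      intro a b; field_simp
    rw [e1]
    linarith
  · simp only [map_neg, add_apply, smul_apply, smul_eq_mul, pow_zero, inv_one,
      one_mul, zero_apply] at *
    linarith

end Iteration

/-! ### Decoupling along a uniformly ergodic chain -/

section Mixing

/-- Two probability measures that are `c`-close on all events have `2bc`-close integrals of functions
bounded by `b`. -/
theorem abs_integral_sub_integral_le {S : Type*} [MeasurableSpace S] {ν π : Measure S}
    [IsProbabilityMeasure ν] [IsProbabilityMeasure π] {c b : ℝ}
    (h : ∀ A, MeasurableSet A → |ν.real A - π.real A| ≤ c) {φ : S → ℝ} (hφ : Measurable φ)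
    (hb : ∀ z, |φ z| ≤ b) : |∫ z, φ z ∂ν - ∫ z, φ z ∂π| ≤ 2 * b * c := by
  have hb0 : 0 ≤ b := by
    obtain ⟨z⟩ := nonempty_of_isProbabilityMeasure ν
    exact (abs_nonneg _).trans (hb z)
  have hint : ∀ ρ : Measure S, IsProbabilityMeasure ρ → Integrable φ ρ := fun ρ _ =>
    Integrable.of_bound hφ.aestronglyMeasurable b (ae_of_all _ hb)
  -- Layer-cake formula for φ + b, which takes values in [0, 2b]: only levels in (0, 2b] count, and
  -- on each level the two measures differ by at most c.
  have hlayer : ∀ ρ : Measure S, IsProbabilityMeasure ρ →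
      ∫ z, φ z ∂ρ = (∫ t in Set.Ioc 0 (2 * b), ρ.real {z | t < φ z + b}) - b := by
    intro ρ _
    have h1 : Integrable (fun z => φ z + b) ρ := (hint ρ inferInstance).add (integrable_const _)
    have h2 := h1.integral_eq_integral_meas_lt
      (ae_of_all _ fun z => by have := abs_le.1 (hb z); simp only [Pi.zero_apply]; linarith)
    rw [integral_add (hint ρ inferInstance) (integrable_const _)] at h2
    simp only [integral_const, probReal_univ, smul_eq_mul, one_mul] at h2
    have h3 : ∫ t in Set.Ioi 0, ρ.real {z | t < φ z + b}
        = ∫ t in Set.Ioc 0 (2 * b), ρ.real {z | t < φ z + b} := by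
      refine (setIntegral_eq_of_subset_of_forall_sdiff_eq_zero measurableSet_Ioi
        Set.Ioc_subset_Ioi_self fun t ht => ?_)
      have h4 : {z | t < φ z + b} = ∅ := by
        ext z
        have := abs_le.1 (hb z)
        simp only [Set.mem_sdiff, Set.mem_Ioi, Set.mem_Ioc, not_and, not_le] at ht
        have := ht.2 ht.1
        simp only [Set.mem_ofPred_eq, Set.mem_empty_iff_false, iff_false, not_lt]
        linarith
      simp [h4]
    linarith
  have hintt : ∀ ρ : Measure S, IsProbabilityMeasure ρ →
      IntegrableOn (fun t => ρ.real {z | t < φ z + b}) (Set.Ioc 0 (2 * b)) := by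
    intro ρ _
    have hanti : Antitone fun t : ℝ => ρ.real {z | t < φ z + b} := fun s t hst =>
      measureReal_mono fun z hz => lt_of_le_of_lt hst hz
    exact Integrable.of_bound hanti.measurable.aestronglyMeasurable 1
      (ae_of_all _ fun t => by
        rw [Real.norm_of_nonneg measureReal_nonneg]; exact measureReal_le_one)
  rw [hlayer ν inferInstance, hlayer π inferInstance, sub_sub_sub_cancel_right,
    ← integral_sub (hintt ν inferInstance) (hintt π inferInstance)]
  have := norm_setIntegral_le_of_norm_le_const (μ := volume) (s := Set.Ioc 0 (2 * b)) (C := c)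
    (f := fun t => ν.real {z | t < φ z + b} - π.real {z | t < φ z + b}) measure_Ioc_lt_top
    (fun t _ => h _ (measurableSet_lt measurable_const (hφ.add_const b)))
  rwa [measureReal_def, Real.volume_Ioc, sub_zero, ENNReal.toReal_ofReal (by positivity),
    Real.norm_eq_abs, mul_comm c] at this

/-! ### The Markov chain seen from its past -/

variable {Ω S : Type*} [MeasurableSpace Ω] [MeasurableSpace S] {μ : Measure Ω}
  {P : Kernel S S} {Z : ℕ → Ω → S}

/-- The sequence `z` stopped at time `s`. -/
def stopSeq {S : Type*} (s : ℕ) (z : ℕ → S) : ℕ → S := fun i => z (min i s)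

theorem measurable_stopSeq (s : ℕ) : Measurable (stopSeq s : (ℕ → S) → ℕ → S) :=
  measurable_pi_lambda _ fun i => measurable_pi_apply (min i s)

theorem isMarkovKernel_pow (P : Kernel S S) [IsMarkovKernel P] (m : ℕ) :
    IsMarkovKernel (P ^ m) := by
  induction m with
  | zero => rw [pow_zero]; exact inferInstanceAs (IsMarkovKernel Kernel.id)
  | succ m ih => rw [pow_succ]; exact inferInstanceAs (IsMarkovKernel ((P ^ m) ∘ₖ P))

theorem IsMarkovChain.measure_inter_succ [IsProbabilityMeasure μ] [IsMarkovKernel P]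
    (hZ : IsMarkovChain μ P Z) (t : ℕ) {B : Set Ω}
    (hB : MeasurableSet[⨆ s ≤ t, MeasurableSpace.comap (Z s) inferInstance] B) {A : Set S}
    (hA : MeasurableSet A) : μ (B ∩ Z (t + 1) ⁻¹' A) = ∫⁻ a in B, P (Z t a) A ∂μ := by
  have hle : (⨆ s ≤ t, MeasurableSpace.comap (Z s) inferInstance) ≤ ‹MeasurableSpace Ω› :=
    iSup₂_le fun s _ => (hZ.measurable s).comap_le
  have hA' : MeasurableSet (Z (t + 1) ⁻¹' A) := hZ.measurable _ hA
  have hint : Integrable ((Z (t + 1) ⁻¹' A).indicator fun _ => (1 : ℝ)) μ :=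
    (integrable_const _).indicator hA'
  have h1 := setIntegral_condExp hle hint hB
  rw [setIntegral_congr_ae (hle _ hB) ((hZ.markov t A hA).mono fun a ha _ => ha),
    integral_indicator hA', setIntegral_const, smul_eq_mul, mul_one, measureReal_restrict_apply hA', Set.inter_comm] at h1
  have h2 : ENNReal.ofReal (∫ a in B, (P (Z t a)).real A ∂μ) = ∫⁻ a in B, P (Z t a) A ∂μ := by
    rw [ofReal_integral_eq_lintegral_ofReal]
    · simp [measureReal_def]
    · refine Integrable.of_bound ?_ 1 (ae_of_all _ fun a => ?_)
      · exact ((P.measurable_coe hA).comp (hZ.measurable t)).ennreal_toReal.aestronglyMeasurable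
      · rw [Real.norm_of_nonneg measureReal_nonneg]; exact measureReal_le_one
    · exact ae_of_all _ fun _ => measureReal_nonneg
  rw [← h2, h1]
  simp [measureReal_def]

/-- The one-step Markov property, iterated. Restricting to an event B of the past up to s is
harmless at the later steps, because B also belongs to the past up to s + m. -/
theorem IsMarkovChain.map_restrict [IsProbabilityMeasure μ] [IsMarkovKernel P]
    (hZ : IsMarkovChain μ P Z) (s m : ℕ) {B : Set Ω}
    (hB : MeasurableSet[⨆ i ≤ s, MeasurableSpace.comap (Z i) inferInstance] B) :
    (μ.restrict B).map (Z (s + m)) = ((μ.restrict B).map (Z s)).bind (P ^ m) := by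
  induction m with
  | zero =>
    rw [pow_zero]
    exact (Measure.bind_dirac).symm
  | succ m ih =>
    have h1 : ((μ.restrict B).map (Z s)).bind (P ^ (m + 1))
        = ((μ.restrict B).map (Z (s + m))).bind P := by
      rw [ih, Measure.bind_bind (P ^ m).aemeasurable P.aemeasurable, pow_succ']
      rfl
    rw [h1]
    ext A hA
    have hB' : MeasurableSet[⨆ i ≤ s + m, MeasurableSpace.comap (Z i) inferInstance] B :=
      iSup₂_mono' (f := fun i (_ : i ≤ s) => MeasurableSpace.comap (Z i) inferInstance)
        (g := fun i (_ : i ≤ s + m) => MeasurableSpace.comap (Z i) inferInstance)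
        (fun i hi => ⟨i, hi.trans (Nat.le_add_right _ _), le_rfl⟩) _ hB
    rw [Measure.map_apply (hZ.measurable _) hA, Measure.restrict_apply (hZ.measurable _ hA),
      Measure.bind_apply hA P.aemeasurable, lintegral_map (P.measurable_coe hA) (hZ.measurable _),
      Set.inter_comm]
    exact hZ.measure_inter_succ (s + m) hB' hA

/-- The joint law of the history up to time `s` and of the state at time `s + m`. -/
theorem IsMarkovChain.map_stopSeq_prod [IsProbabilityMeasure μ] [IsMarkovKernel P]
    (hZ : IsMarkovChain μ P Z) (s m : ℕ) :
    μ.map (fun a => (stopSeq s (fun i => Z i a), Z (s + m) a))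
      = (μ.map fun a => stopSeq s (fun i => Z i a)) ⊗ₘ
        ((P ^ m).comap (fun z : ℕ → S => z s) (measurable_pi_apply s)) := by
  have hY : Measurable fun a => stopSeq s (fun i => Z i a) :=
    (measurable_stopSeq s).comp (measurable_pi_lambda _ hZ.measurable)
  have hYle : MeasurableSpace.comap (fun a => stopSeq s (fun i => Z i a)) inferInstance
      ≤ ⨆ i ≤ s, MeasurableSpace.comap (Z i) inferInstance := by
    rw [← measurable_iff_comap_le]
    refine @measurable_pi_lambda _ _ _ (_) _ _ fun i => ?_
    rw [measurable_iff_comap_le]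
    exact le_iSup₂_of_le (min i s) (min_le_right _ _) le_rfl
  have hY' := Measure.isProbabilityMeasure_map (μ := μ) hY.aemeasurable
  have hpair : Measurable fun a => (stopSeq s (fun i => Z i a), Z (s + m) a) :=
    hY.prodMk (hZ.measurable _)
  have := Measure.isProbabilityMeasure_map (μ := μ) hpair.aemeasurable
  have hPm := isMarkovKernel_pow P m
  refine Measure.ext_prod fun {A C} hA hC => ?_
  rw [Measure.map_apply hpair (hA.prod hC), Measure.compProd_apply_prod hA hC,
    setLIntegral_map hA (Kernel.measurable_coe _ hC) hY]
  have h1 := congrArg (fun ρ => ρ C) (hZ.map_restrict s m (hYle _ ⟨A, hA, rfl⟩))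
  rw [Measure.map_apply (hZ.measurable _) hC, Measure.restrict_apply (hZ.measurable _ hC),
      Measure.bind_apply hC (P ^ m).aemeasurable,
      lintegral_map ((P ^ m).measurable_coe hC) (hZ.measurable _)] at h1
  rw [Set.mk_preimage_prod, Set.inter_comm, h1]
  simp [Kernel.comap_apply, stopSeq]

/-- The mean of a `π`-centred function of the state `m` steps ahead, with a coefficient that
depends on the history, is geometrically small. -/
theorem IsMarkovChain.integral_le [IsProbabilityMeasure μ] [IsMarkovKernel P] {π : Measure S}
    [IsProbabilityMeasure π] {C₀ τ : ℝ} (hP : IsUniformlyErgodic P π C₀ τ)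
    (hZ : IsMarkovChain μ P Z) (s : ℕ) {m : ℕ} (hm : 0 < m) {φ : (ℕ → S) → S → ℝ}
    (hφ : Measurable (Function.uncurry φ)) {b : ℝ} (hb : ∀ z w, |φ z w| ≤ b)
    (h0 : ∀ z, ∫ w, φ z w ∂π = 0) :
    ∫ a, φ (stopSeq s (fun i => Z i a)) (Z (s + m) a) ∂μ
      ≤ 2 * b * (C₀ * (1 / 2 : ℝ) ^ ((m : ℝ) / τ)) := by
  have hY : Measurable fun a => stopSeq s (fun i => Z i a) :=
    (measurable_stopSeq s).comp (measurable_pi_lambda _ hZ.measurable)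
  have hpair : Measurable fun a => (stopSeq s (fun i => Z i a), Z (s + m) a) :=
    hY.prodMk (hZ.measurable _)
  have hY' := Measure.isProbabilityMeasure_map (μ := μ) hY.aemeasurable
  have hPm := isMarkovKernel_pow P m
  have h1 : ∫ a, φ (stopSeq s (fun i => Z i a)) (Z (s + m) a) ∂μ
      = ∫ p, Function.uncurry φ p ∂(μ.map fun a => (stopSeq s (fun i => Z i a), Z (s + m) a)) := by
    rw [integral_map hpair.aemeasurable hφ.aestronglyMeasurable]; rfl
  rw [h1, hZ.map_stopSeq_prod, Measure.integral_compProd]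
  · have h2 : ∀ z, ‖∫ w, Function.uncurry φ (z, w)
        ∂((P ^ m).comap (fun z : ℕ → S => z s) (measurable_pi_apply s)) z‖
        ≤ 2 * b * (C₀ * (1 / 2 : ℝ) ^ ((m : ℝ) / τ)) := by
      intro z
      -- Given the history, the later state has law P^m(z_s, ·), which is close to π uniformly in
      -- z_s, and the integral against π vanishes.
      have h3 := abs_integral_sub_integral_le (fun A hA => hP.mixing m hm (z s) A hA)
        (hφ.comp measurable_prodMk_left) (hb z)
      rw [Kernel.comap_apply]
      simp only [Function.comp_def, Function.uncurry_apply_pair, h0, sub_zero] at h3 ⊢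
      exact h3
    have h4 := norm_integral_le_of_norm_le_const
      (μ := μ.map fun a => stopSeq s (fun i => Z i a)) (ae_of_all _ h2)
    rw [probReal_univ, mul_one] at h4
    exact (Real.le_norm_self _).trans h4
  · exact Integrable.of_bound hφ.aestronglyMeasurable b (ae_of_all _ fun p => hb p.1 p.2)

end Mixing

/-! ### Measurability of the oracle and of the prox mapping -/

/-- Since x never leaves the closed set X, g can be replaced off X by a constant, which makes it a
Borel map on the whole space. -/
theorem measurable_comp_of_continuousOn {E Ω : Type*} [TopologicalSpace E] [MeasurableSpace E]
    [BorelSpace E] [MeasurableSpace Ω] {X : Set E} (hX : IsClosed X) {G : Type*}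
    [TopologicalSpace G] [MeasurableSpace G] [BorelSpace G] {g : E → G} (hg : ContinuousOn g X)
    {x : Ω → E} (hx : Measurable x) (hxX : ∀ a, x a ∈ X) : Measurable fun a => g (x a) := by
  classical
  by_cases hΩ : Nonempty Ω
  · obtain ⟨a₀⟩ := hΩ
    have h1 : Measurable (X.piecewise g fun _ => g (x a₀)) :=
      hg.measurable_piecewise continuousOn_const hX.measurableSet
    have h2 : (fun a => g (x a)) = (X.piecewise g fun _ => g (x a₀)) ∘ x := by
      funext a; simp [hxX a]
    rw [h2]
    exact h1.comp hx
  · rw [not_nonempty_iff] at hΩ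
    exact measurable_of_empty _

section Oracle

variable {E S : Type*} [NormedAddCommGroup E] [NormedSpace ℝ E] [MeasurableSpace S]

/-- The noise of the stochastic gradient at the points of `X`, and `0` elsewhere. -/
def centredGrad (X : Set E) (π : Measure S) (F : E → S → ℝ) (x : E) (z : S) : E →L[ℝ] ℝ :=
  X.indicator (fun x => stochGrad F x z - fderiv ℝ (objective π F) x) x

variable {X : Set E} {π : Measure S} {F : E → S → ℝ} {L σ : ℝ}

theorem centredGrad_of_mem {x : E} (hx : x ∈ X) (z : S) :
    centredGrad X π F x z = stochGrad F x z - fderiv ℝ (objective π F) x := by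
  simp [centredGrad, hx]

theorem IsSmoothOn.continuousOn_fderiv {f : E → ℝ} (hf : IsSmoothOn X L f) :
    ContinuousOn (fderiv ℝ f) X := by
  have hL : LipschitzOnWith (Real.toNNReal L) (fderiv ℝ f) X := by
    refine LipschitzOnWith.of_dist_le_mul fun x hx y hy => ?_
    rw [dist_eq_norm, dist_eq_norm]
    refine (hf.2 x hx y hy).trans ?_
    gcongr
    exact Real.le_coe_toNNReal L
  exact hL.continuousOn

theorem norm_centredGrad_le (hσ : 0 ≤ σ) (hF : IsBoundedNoiseOracle X π F σ) (x : E) (z : S) :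
    ‖centredGrad X π F x z‖ ≤ σ := by
  by_cases hx : x ∈ X
  · rw [centredGrad_of_mem hx]
    exact abs_le_of_sq_le_sq' (hF.bounded x hx z) hσ |>.2
  · simpa [centredGrad, hx] using hσ

end Oracle

section Measurability

variable {E S Ω : Type*} [NormedAddCommGroup E] [NormedSpace ℝ E] [FiniteDimensional ℝ E]
  [MeasurableSpace S] [MeasurableSpace Ω]

theorem measurable_dual_of_apply {v : Ω → E →L[ℝ] ℝ} (h : ∀ u, Measurable fun a => v a u) :
    Measurable v := by
  let b := Module.finBasis ℝ E
  have h1 : v = fun a => ∑ i, v a (b i) • LinearMap.toContinuousLinearMap (b.coord i) := by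
    funext a
    ext u
    have h2 := congrArg (v a) (b.sum_repr u)
    simp only [map_sum, map_smul, smul_eq_mul] at h2
    simp [← h2, mul_comm]
  rw [h1]
  exact Finset.measurable_sum _ fun i _ => (h (b i)).smul_const _

variable [MeasurableSpace E] [BorelSpace E]

theorem measurable_dual_apply {v : Ω → E →L[ℝ] ℝ} {w : Ω → E} (hv : Measurable v)
    (hw : Measurable w) : Measurable fun a => v a (w a) :=
  (isBoundedBilinearMap_apply (𝕜 := ℝ) (E := E) (F := ℝ)).continuous.measurable.comp
    (hv.prodMk hw)

/-- By the Lipschitz estimate the base point may be frozen at x(a₀): the prox point is a fixed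
continuous function of ξ - ω'(x). -/
theorem measurable_prox {X : Set E} {ω : E → ℝ} {ω' : E → E →L[ℝ] ℝ}
    (h : IsDistanceGenerating X ω ω') (hX : IsCompact X) {x : Ω → E} (hx : Measurable x)
    (hxX : ∀ a, x a ∈ X) {ξ : Ω → E →L[ℝ] ℝ} (hξ : Measurable ξ) :
    Measurable fun a => prox X ω ω' (x a) (ξ a) := by
  by_cases hΩ : Nonempty Ω
  · obtain ⟨a₀⟩ := hΩ
    have hlip : LipschitzWith 1 fun η => prox X ω ω' (x a₀) (η + ω' (x a₀)) := by
      refine LipschitzWith.of_dist_le_mul fun η₁ η₂ => ?_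
      simpa [dist_eq_norm] using norm_prox_sub_prox_le h hX (hxX a₀) (hxX a₀)
        (η₁ + ω' (x a₀)) (η₂ + ω' (x a₀))
    have h1 : (fun a => prox X ω ω' (x a) (ξ a))
        = (fun η => prox X ω ω' (x a₀) (η + ω' (x a₀))) ∘ fun a => ξ a - ω' (x a) := by
      funext a
      have := norm_prox_sub_prox_le h hX (hxX a) (hxX a₀) (ξ a) (ξ a - ω' (x a) + ω' (x a₀))
      simpa [sub_eq_zero] using this
    rw [h1]
    exact hlip.continuous.measurable.comp
      (hξ.sub (measurable_comp_of_continuousOn hX.isClosed h.continuousOn hx hxX))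
  · rw [not_nonempty_iff] at hΩ
    exact measurable_of_empty _

variable {X : Set E} {π : Measure S} {F : E → S → ℝ} {L σ : ℝ}

/-- Each directional derivative is a pointwise limit of difference quotients of the jointly
measurable loss, and finitely many directions determine a functional. -/
theorem measurable_indicator_stochGrad (hX : MeasurableSet X) (hFm : Measurable (Function.uncurry F))
    (hF : IsBoundedNoiseOracle X π F σ) :
    Measurable fun q : E × S => X.indicator (fun x => stochGrad F x q.2) q.1 := by
  classical
  refine measurable_dual_of_apply fun u => ?_
  have hset : MeasurableSet {q : E × S | q.1 ∈ X} := measurable_fst hX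
  refine measurable_of_tendsto_metrizable (f := fun (n : ℕ) (q : E × S) =>
    {q : E × S | q.1 ∈ X}.indicator (fun q => ((n : ℝ) + 1) *
      (F (q.1 + ((n : ℝ) + 1)⁻¹ • u) q.2 - F q.1 q.2)) q) (fun n => ?_) ?_
  · refine Measurable.indicator ?_ hset
    have h1 : Measurable fun q : E × S => F (q.1 + ((n : ℝ) + 1)⁻¹ • u) q.2 :=
      hFm.comp ((measurable_fst.add_const _).prodMk measurable_snd)
    exact (h1.sub hFm).const_mul _
  · rw [tendsto_pi_nhds]
    rintro ⟨x, z⟩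
    by_cases hx : x ∈ X
    · have h1 : HasFDerivAt (fun y => F y z) (stochGrad F x z) x :=
        (hF.differentiable x hx z).hasFDerivAt
      have h2 := (h1.lim_real u).comp
        (tendsto_atTop_add_const_right _ (1 : ℝ) tendsto_natCast_atTop_atTop)
      simpa [hx, Function.comp_def] using h2
    · simp [hx]

theorem measurable_centredGrad (hX : IsClosed X) (hf : IsSmoothOn X L (objective π F))
    (hFm : Measurable (Function.uncurry F)) (hF : IsBoundedNoiseOracle X π F σ) :
    Measurable (Function.uncurry (centredGrad X π F)) := by
  classical
  have h1 := measurable_indicator_stochGrad hX.measurableSet hFm hF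
  have h2 : Measurable (X.indicator (fderiv ℝ (objective π F))) := by
    rw [← Set.piecewise_eq_indicator]
    exact hf.continuousOn_fderiv.measurable_piecewise continuousOn_const hX.measurableSet
  have h3 : Function.uncurry (centredGrad X π F) = fun q : E × S =>
      X.indicator (fun x => stochGrad F x q.2) q.1
        - X.indicator (fderiv ℝ (objective π F)) q.1 := by
    funext q
    by_cases hx : q.1 ∈ X <;> simp [centredGrad, Function.uncurry, hx]
  rw [h3]
  exact h1.sub (h2.comp measurable_fst)

theorem integral_centredGrad_apply [IsProbabilityMeasure π] (hX : IsClosed X)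
    (hf : IsSmoothOn X L (objective π F)) (hFm : Measurable (Function.uncurry F)) (hσ : 0 ≤ σ)
    (hF : IsBoundedNoiseOracle X π F σ) (x u : E) : ∫ z, centredGrad X π F x z u ∂π = 0 := by
  have hm : Measurable (centredGrad X π F x) :=
    (measurable_centredGrad hX hf hFm hF).comp measurable_prodMk_left
  have hint : Integrable (centredGrad X π F x) π :=
    Integrable.of_bound hm.aestronglyMeasurable σ
      (ae_of_all _ fun z => norm_centredGrad_le hσ hF x z)
  rw [← ContinuousLinearMap.integral_apply hint]
  by_cases hx : x ∈ X
  · have h1 : stochGrad F x = fun z => centredGrad X π F x z + fderiv ℝ (objective π F) x := by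
      funext z; rw [centredGrad_of_mem hx]; abel
    have h2 := hF.unbiased x hx
    rw [h1, integral_add hint (integrable_const _)] at h2
    simp only [integral_const, probReal_univ, one_smul, add_eq_right] at h2
    rw [h2, zero_apply]
  · simp [centredGrad, hx]

end Measurability

/-! ### The conjugate bound along a uniformly ergodic chain -/

section BatchNoise

variable {E S : Type*} [NormedAddCommGroup E] [NormedSpace ℝ E]

/-- A crude pathwise bound, quadratic in n; it only serves integrability. -/
theorem abs_conjBound_le {X : Set E} {ω : E → ℝ} {ω' : E → E →L[ℝ] ℝ}
    (hd : IsDistanceGenerating X ω ω') (hX : IsCompact X) {x : E} (hx : x ∈ X)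
    {v : ℕ → E →L[ℝ] ℝ} {b : ℝ} (hv : ∀ i, ‖v i‖ ≤ b) (n : ℕ) :
    |conjBound X ω ω' x v n| ≤ (n : ℝ) ^ 2 * b ^ 2 := by
  have hb : 0 ≤ b := (norm_nonneg _).trans (hv 0)
  rw [conjBound_eq_sum hd hX hx]
  have h1 : ∀ k ∈ Finset.Icc 1 n, |∑ l ∈ Finset.Icc 1 k, v k (proxStep X ω ω' x v l)|
      ≤ n * b ^ 2 := by
    intro k hk
    rw [Finset.mem_Icc] at hk
    refine (Finset.abs_sum_le_sum_abs _ _).trans ?_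
    refine (Finset.sum_le_card_nsmul _ _ (b ^ 2) fun l hl => ?_).trans ?_
    · rw [Finset.mem_Icc] at hl
      rw [← Real.norm_eq_abs, sq]
      exact ((v k).le_opNorm _).trans (mul_le_mul (hv k)
        ((norm_proxStep_le hd hX hx v hl.1).trans (hv l)) (norm_nonneg _) hb)
    · rw [Nat.card_Icc, Nat.add_sub_cancel, nsmul_eq_mul]
      have : (k : ℝ) ≤ n := by exact_mod_cast hk.2
      gcongr
  refine (Finset.abs_sum_le_sum_abs _ _).trans ((Finset.sum_le_card_nsmul _ _ _ h1).trans ?_)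
  rw [Nat.card_Icc, Nat.add_sub_cancel, nsmul_eq_mul, sq (n : ℝ), mul_assoc]

/-- Bernoulli's inequality for the exponent 1/τ ≤ 1. It says that the geometric series with ratio
2^{-1/τ} sums to at most 2τ, the source of the factor τ. -/
theorem one_sub_half_rpow_inv_ge {τ : ℝ} (hτ : 1 ≤ τ) :
    1 ≤ 2 * τ * (1 - (1 / 2 : ℝ) ^ (1 / τ)) := by
  have hτ0 : 0 < τ := by linarith
  have h := rpow_one_add_le_one_add_mul_self (s := -(1 / 2 : ℝ)) (p := 1 / τ) (by norm_num)
    (by positivity) (by rw [div_le_one hτ0]; exact hτ)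
  have h1 : (1 : ℝ) + -(1 / 2) = 1 / 2 := by norm_num
  rw [h1] at h
  have h2 : 2 * τ * (1 - (1 + 1 / τ * -(1 / 2))) = 1 := by field_simp; ring
  refine h2.ge.trans ?_
  gcongr

theorem sum_Icc_pow_sub_le {r c : ℝ} (hr : 0 ≤ r) (hc0 : 0 ≤ c) (hc : 1 ≤ c * (1 - r)) (k : ℕ) :
    ∑ l ∈ Finset.Icc 1 k, r ^ (k - l) ≤ c := by
  induction k with
  | zero => simpa using hc0
  | succ k ih =>
    rw [Finset.sum_Icc_succ_top (by omega)]
    have h1 : ∑ l ∈ Finset.Icc 1 k, r ^ (k + 1 - l) = r * ∑ l ∈ Finset.Icc 1 k, r ^ (k - l) := by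
      rw [Finset.mul_sum]
      refine Finset.sum_congr rfl fun l hl => ?_
      rw [Finset.mem_Icc] at hl
      rw [show k + 1 - l = (k - l) + 1 by omega, pow_succ']
    rw [h1, Nat.sub_self, pow_zero]
    nlinarith [mul_le_mul_of_nonneg_left ih hr]

theorem stopSeq_stopSeq {s t : ℕ} (h : s ≤ t) (z : ℕ → S) :
    stopSeq s (stopSeq t z) = stopSeq s z := by
  funext i
  simp only [stopSeq]
  congr 1
  omega

variable [FiniteDimensional ℝ E] [MeasurableSpace E] [BorelSpace E] [MeasurableSpace S]
  {Ω : Type*} [MeasurableSpace Ω]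

theorem measurable_proxStep {X : Set E} {ω : E → ℝ} {ω' : E → E →L[ℝ] ℝ}
    (hd : IsDistanceGenerating X ω ω') (hX : IsCompact X) {x : Ω → E} (hx : Measurable x)
    (hxX : ∀ a, x a ∈ X) {v : Ω → ℕ → E →L[ℝ] ℝ} (hv : ∀ i, Measurable fun a => v a i) (l : ℕ) :
    Measurable fun a => proxStep X ω ω' (x a) (v a) l :=
  (measurable_prox hd hX hx hxX (Finset.measurable_sum _ fun i _ => hv i).neg).sub
    (measurable_prox hd hX hx hxX (Finset.measurable_sum _ fun i _ => hv i).neg)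

theorem measurable_conjBound {X : Set E} {ω : E → ℝ} {ω' : E → E →L[ℝ] ℝ}
    (hd : IsDistanceGenerating X ω ω') (hX : IsCompact X) {x : Ω → E} (hx : Measurable x)
    (hxX : ∀ a, x a ∈ X) {v : Ω → ℕ → E →L[ℝ] ℝ} (hv : ∀ i, Measurable fun a => v a i) (n : ℕ) :
    Measurable fun a => conjBound X ω ω' (x a) (v a) n :=
  Finset.measurable_sum _ fun k _ => measurable_dual_apply (hv k)
    ((measurable_prox hd hX hx hxX (Finset.measurable_sum _ fun i _ => hv i).neg).sub hx)

variable {μ : Measure Ω} [IsProbabilityMeasure μ] {P : Kernel S S} [IsMarkovKernel P]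
  {π : Measure S} [IsProbabilityMeasure π] {C₀ τ : ℝ} {Z : ℕ → Ω → S} {X : Set E} {ω : E → ℝ}
  {ω' : E → E →L[ℝ] ℝ} {H : E → S → E →L[ℝ] ℝ} {σ : ℝ}

/-- The expectation of the conjugate bound for a batch of `n` centred terms, weighted by `c`, is at
most `c² σ² n` times the mixing time, up to a factor that depends only on `C₀`. -/
theorem integral_conjBound_le (hτ : 1 ≤ τ) (hP : IsUniformlyErgodic P π C₀ τ)
    (hZ : IsMarkovChain μ P Z) (hd : IsDistanceGenerating X ω ω') (hX : IsCompact X)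
    (hHm : Measurable (Function.uncurry H)) (hHb : ∀ x z, ‖H x z‖ ≤ σ)
    (hH0 : ∀ x u, ∫ z, H x z u ∂π = 0) {x y : (ℕ → S) → E} (hx : Measurable x) (hy : Measurable y)
    (hxX : ∀ z, x z ∈ X) {N : ℕ} (hxN : ∀ z, x (stopSeq N z) = x z)
    (hyN : ∀ z, y (stopSeq N z) = y z) (c : ℝ) (n : ℕ) :
    ∫ a, conjBound X ω ω' (x fun i => Z i a)
        (fun i => c • H (y fun i => Z i a) (Z (N + i) a)) n ∂μ
      ≤ c ^ 2 * σ ^ 2 * n * τ * (1 + 4 * |C₀|) := by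
  set r : ℝ := (1 / 2 : ℝ) ^ (1 / τ) with hr
  have hr0 : 0 ≤ r := by positivity
  have hτ0 : 0 < τ := by linarith
  set v : (ℕ → S) → ℕ → E →L[ℝ] ℝ := fun z i => c • H (y z) (z (N + i)) with hvdef
  have hvm : ∀ i, Measurable fun z => v z i := fun i =>
    (hHm.comp (hy.prodMk (measurable_pi_apply _))).const_smul c
  have hvb : ∀ z i, ‖v z i‖ ≤ |c| * σ := fun z i => by
    rw [hvdef]
    simp only [norm_smul, Real.norm_eq_abs]
    exact mul_le_mul_of_nonneg_left (hHb _ _) (abs_nonneg _)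
  have hcσ : 0 ≤ |c| * σ := by
    obtain ⟨w⟩ := nonempty_of_isProbabilityMeasure π
    exact (norm_nonneg _).trans (hvb (fun _ => w) 0)
  have hWm : ∀ l, Measurable fun z => proxStep X ω ω' (x z) (v z) l := fun l =>
    measurable_proxStep hd hX hx hxX hvm l
  have hZm : Measurable fun a => fun i => Z i a := measurable_pi_lambda _ hZ.measurable
  -- The points x and y are known at time N and the l-th increment uses only v_1, ..., v_l, so it is
  -- a function of the samples up to N + l.
  have hhist : ∀ l z, proxStep X ω ω' (x (stopSeq (N + l) z)) (v (stopSeq (N + l) z)) l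
      = proxStep X ω ω' (x z) (v z) l := by
    intro l z
    have e1 : x (stopSeq (N + l) z) = x z := by
      rw [← hxN, stopSeq_stopSeq (Nat.le_add_right _ _), hxN]
    have e2 : y (stopSeq (N + l) z) = y z := by
      rw [← hyN, stopSeq_stopSeq (Nat.le_add_right _ _), hyN]
    have e3 : ∀ i ≤ l, v (stopSeq (N + l) z) i = v z i := by
      intro i hi
      simp only [hvdef, e2, stopSeq]
      rw [min_eq_left (by omega)]
    unfold proxStep
    rw [e1, Finset.sum_congr rfl fun i hi => e3 i (Finset.mem_Icc.1 hi).2,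
      Finset.sum_congr rfl fun i hi => e3 i ((Finset.mem_Icc.1 hi).2.trans (Nat.sub_le _ _))]
  have hpt : ∀ w : E →L[ℝ] ℝ, ‖w‖ ≤ |c| * σ → ∀ z l, 1 ≤ l →
      |w (proxStep X ω ω' (x z) (v z) l)| ≤ c ^ 2 * σ ^ 2 := by
    intro w hw z l hl
    rw [← Real.norm_eq_abs, ← sq_abs c, ← mul_pow, sq]
    exact (w.le_opNorm _).trans (mul_le_mul hw
      ((norm_proxStep_le hd hX (hxX z) _ hl).trans (hvb z l)) (norm_nonneg _) hcσ)
  -- On the diagonal l = k nothing decouples and the pointwise bound c²σ² is used; below it, mixing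
  -- over k - l > 0 steps applies.
  have hterm : ∀ k, ∀ l ∈ Finset.Icc 1 k,
      ∫ a, v (fun i => Z i a) k (proxStep X ω ω' (x fun i => Z i a) (v fun i => Z i a) l) ∂μ
        ≤ c ^ 2 * σ ^ 2 * (2 * |C₀| * r ^ (k - l) + if l = k then 1 else 0) := by
    intro k l hl
    rw [Finset.mem_Icc] at hl
    split_ifs with hlk
    · have h1 := norm_integral_le_of_norm_le_const (μ := μ) (C := c ^ 2 * σ ^ 2)
        (f := fun a => v (fun i => Z i a) k
          (proxStep X ω ω' (x fun i => Z i a) (v fun i => Z i a) l)) (ae_of_all μ fun a =>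
        hpt (v (fun i => Z i a) k) (hvb _ _) (fun i => Z i a) l hl.1)
      rw [probReal_univ, mul_one] at h1
      refine (Real.le_norm_self _).trans (h1.trans ?_)
      have : 0 ≤ 2 * |C₀| * r ^ (k - l) := by positivity
      nlinarith [mul_nonneg (mul_nonneg (sq_nonneg c) (sq_nonneg σ)) this]
    · have hlt : l < k := lt_of_le_of_ne hl.2 hlk
      have h1 := hZ.integral_le hP (N + l) (m := k - l) (by omega)
        (φ := fun z w => (c • H (y z) w) (proxStep X ω ω' (x z) (v z) l)) ?_
        (fun z w => hpt _ ?_ z l hl.1) (fun z => ?_)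
      · simp only [hhist] at h1
        have e2 : ∀ z, y (stopSeq (N + l) z) = y z := fun z => by
          rw [← hyN, stopSeq_stopSeq (Nat.le_add_right _ _), hyN]
        simp only [e2] at h1
        rw [show N + l + (k - l) = N + k by omega] at h1
        refine h1.trans ?_
        have h3 : (1 / 2 : ℝ) ^ (((k - l : ℕ) : ℝ) / τ) = r ^ (k - l) := by
          rw [hr, ← Real.rpow_natCast, ← Real.rpow_mul (by norm_num)]
          congr 1
          ring
        rw [h3, add_zero]
        have h4 : C₀ * r ^ (k - l) ≤ |C₀| * r ^ (k - l) :=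
          mul_le_mul_of_nonneg_right (le_abs_self _) (by positivity)
        nlinarith [mul_le_mul_of_nonneg_left h4 (mul_nonneg (sq_nonneg c) (sq_nonneg σ))]
      · exact measurable_dual_apply
          ((hHm.comp ((hy.comp measurable_fst).prodMk measurable_snd)).const_smul c)
          ((hWm l).comp measurable_fst)
      · rw [norm_smul, Real.norm_eq_abs]
        exact mul_le_mul_of_nonneg_left (hHb _ _) (abs_nonneg _)
      · simp only [smul_apply, smul_eq_mul]
        rw [integral_const_mul, hH0, mul_zero]
  have hint : ∀ k, ∀ l ∈ Finset.Icc 1 k, Integrable (fun a => v (fun i => Z i a) k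
      (proxStep X ω ω' (x fun i => Z i a) (v fun i => Z i a) l)) μ := by
    intro k l hl
    refine Integrable.of_bound ?_ (c ^ 2 * σ ^ 2)
      (ae_of_all _ fun a => hpt _ (hvb _ _) _ _ (Finset.mem_Icc.1 hl).1)
    exact (measurable_dual_apply ((hvm k).comp hZm) ((hWm l).comp hZm)).aestronglyMeasurable
  have hsum : ∀ a, conjBound X ω ω' (x fun i => Z i a) (v fun i => Z i a) n
      = ∑ k ∈ Finset.Icc 1 n, ∑ l ∈ Finset.Icc 1 k, v (fun i => Z i a) k
        (proxStep X ω ω' (x fun i => Z i a) (v fun i => Z i a) l) :=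
    fun a => conjBound_eq_sum hd hX (hxX _) _ n
  calc ∫ a, conjBound X ω ω' (x fun i => Z i a) (v fun i => Z i a) n ∂μ
      = ∑ k ∈ Finset.Icc 1 n, ∑ l ∈ Finset.Icc 1 k, ∫ a, v (fun i => Z i a) k
        (proxStep X ω ω' (x fun i => Z i a) (v fun i => Z i a) l) ∂μ := by
        simp only [hsum]
        rw [integral_finsetSum _ fun k _ => integrable_finsetSum _ fun l hl => hint k l hl]
        exact Finset.sum_congr rfl fun k _ => integral_finsetSum _ fun l hl => hint k l hl
    _ ≤ ∑ k ∈ Finset.Icc 1 n, c ^ 2 * σ ^ 2 * (τ * (1 + 4 * |C₀|)) := by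
        refine Finset.sum_le_sum fun k hk => ?_
        refine (Finset.sum_le_sum (hterm k)).trans ?_
        rw [← Finset.mul_sum, Finset.sum_add_distrib, ← Finset.mul_sum]
        refine mul_le_mul_of_nonneg_left ?_ (by positivity)
        -- Off-diagonal terms give 2|C₀| · 2τ and the diagonal gives 1 ≤ τ, whence τ(1 + 4|C₀|).
        have h1 := sum_Icc_pow_sub_le hr0 (by positivity) (one_sub_half_rpow_inv_ge hτ) k
        have h2 : ∑ l ∈ Finset.Icc 1 k, (if l = k then (1 : ℝ) else 0) = 1 := by
          rw [Finset.sum_ite_eq', if_pos]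
          exact Finset.mem_Icc.2 ⟨(Finset.mem_Icc.1 hk).1, le_rfl⟩
        rw [h2]
        nlinarith [mul_le_mul_of_nonneg_left h1 (abs_nonneg C₀)]
    _ = c ^ 2 * σ ^ 2 * n * τ * (1 + 4 * |C₀|) := by
        rw [Finset.sum_const, Nat.card_Icc, Nat.add_sub_cancel, nsmul_eq_mul]
        ring

end BatchNoise

/-! ### The iterates -/

section Iterates

variable {E S : Type*} [NormedAddCommGroup E] [NormedSpace ℝ E] {X : Set E} {ω : E → ℝ}
  {ω' : E → E →L[ℝ] ℝ} {F : E → S → ℝ} {β γ : ℕ → ℝ} {M : ℕ} {x₀ : E}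

theorem State.xg_mem (hX : Convex ℝ X) {s : State E} (hx : s.x ∈ X) (hxf : s.xf ∈ X) {b : ℝ}
    (hb : 1 ≤ b) : s.xg b ∈ X := by
  have hb0 : 0 < b := by linarith
  exact hX hx hxf (by positivity) (sub_nonneg.2 (inv_le_one_of_one_le₀ hb)) (by ring)

theorem run_mem (hd : IsDistanceGenerating X ω ω') (hX : IsCompact X) (hβ : ∀ t, 1 ≤ β t)
    (hx₀ : x₀ ∈ X) (z : ℕ → S) (j : ℕ → ℕ) (t : ℕ) :
    (run X ω ω' F β γ M 1 x₀ z j t).x ∈ X ∧ (run X ω ω' F β γ M 1 x₀ z j t).xf ∈ X := by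
  induction t with
  | zero => exact ⟨hx₀, hx₀⟩
  | succ t ih =>
    have hx := prox_mem hd hX ih.1 (γ t • gradEstimator F M 1 z
      ((run X ω ω' F β γ M 1 x₀ z j t).xg (β t)) (run X ω ω' F β γ M 1 x₀ z j t).N (j t))
    exact ⟨hx, State.xg_mem hd.strongConvex.1 (s := ⟨_, _, 0⟩) hx ih.2 (hβ t)⟩

theorem run_xg_mem (hd : IsDistanceGenerating X ω ω') (hX : IsCompact X) (hβ : ∀ t, 1 ≤ β t)
    (hx₀ : x₀ ∈ X) (z : ℕ → S) (j : ℕ → ℕ) (t : ℕ) :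
    (run X ω ω' F β γ M 1 x₀ z j t).xg (β t) ∈ X :=
  have h := run_mem hd hX hβ hx₀ z j t
  State.xg_mem hd.strongConvex.1 h.1 h.2 (hβ t)

/-- The number of samples consumed before iteration `t`. -/
def sampleCount (j : ℕ → ℕ) (t : ℕ) : ℕ := ∑ i ∈ Finset.range t, 2 ^ j i

theorem run_N (z : ℕ → S) (j : ℕ → ℕ) (t : ℕ) :
    (run X ω ω' F β γ M 1 x₀ z j t).N = sampleCount j t := by
  induction t with
  | zero => rfl
  | succ t ih =>
    rw [sampleCount, Finset.sum_range_succ, ← sampleCount, ← ih]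
    simp [run]

/-- The state before iteration t involves the exponents before t only; this is what makes J_t
independent of it. -/
theorem run_congr_exponents (z : ℕ → S) {j j' : ℕ → ℕ} {t : ℕ} (h : ∀ i < t, j i = j' i) :
    run X ω ω' F β γ M 1 x₀ z j t = run X ω ω' F β γ M 1 x₀ z j' t := by
  induction t with
  | zero => rfl
  | succ t ih =>
    rw [run, run, ih fun i hi => h i (hi.trans t.lt_succ_self), h t t.lt_succ_self]

theorem batchGrad_congr {z z' : ℕ → S} {N m : ℕ} (h : ∀ i ≤ m, z i = z' i) (x : E) {j : ℕ}
    (hj : N + 2 ^ j ≤ m) : batchGrad F 1 z x N j = batchGrad F 1 z' x N j := by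
  unfold batchGrad
  congr 1
  refine Finset.sum_congr rfl fun i hi => ?_
  rw [Finset.mem_Icc, mul_one] at hi
  rw [h _ (by omega)]

theorem gradEstimator_congr {z z' : ℕ → S} {N m : ℕ} (h : ∀ i ≤ m, z i = z' i) (x : E) {J : ℕ}
    (hj : N + 2 ^ J ≤ m) : gradEstimator F M 1 z x N J = gradEstimator F M 1 z' x N J := by
  have h1 : 2 ^ 0 ≤ 2 ^ J := Nat.pow_le_pow_right (by norm_num) (Nat.zero_le _)
  have h2 : 2 ^ (J - 1) ≤ 2 ^ J := Nat.pow_le_pow_right (by norm_num) (Nat.sub_le _ _)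
  unfold gradEstimator
  rw [batchGrad_congr h x (j := 0) (by omega), batchGrad_congr h x hj,
    batchGrad_congr h x (j := J - 1) (by omega)]

theorem run_congr_samples {z z' : ℕ → S} (j : ℕ → ℕ) {t : ℕ}
    (h : ∀ i ≤ sampleCount j t, z i = z' i) :
    run X ω ω' F β γ M 1 x₀ z j t = run X ω ω' F β γ M 1 x₀ z' j t := by
  induction t with
  | zero => rfl
  | succ t ih =>
    have h1 : sampleCount j (t + 1) = sampleCount j t + 2 ^ j t := by
      rw [sampleCount, Finset.sum_range_succ, ← sampleCount]
    rw [run, run, ih fun i hi => h i (h1 ▸ hi.trans (Nat.le_add_right _ _)), gradEstimator_congr h _ (by rw [run_N, h1])]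

/-- With the exponents frozen, N_t is a deterministic time and the state before iteration t is a
function of the samples up to N_t. -/
theorem run_stopSeq (z : ℕ → S) (j : ℕ → ℕ) (t : ℕ) :
    run X ω ω' F β γ M 1 x₀ (stopSeq (sampleCount j t) z) j t
      = run X ω ω' F β γ M 1 x₀ z j t :=
  run_congr_samples j fun i hi => by simp [stopSeq, hi]

variable [MeasurableSpace S] {π : Measure S}

/-- The exact gradient is the same in every dyadic mean, so it survives in g_0 and cancels in g_J -
g_{J-1}. -/
theorem gradEstimator_eq {x : E} (hx : x ∈ X) (z : ℕ → S) (N J : ℕ) :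
    gradEstimator F M 1 z x N J = fderiv ℝ (objective π F) x
      + multilevel (fun i => centredGrad X π F x (z (N + i))) M J := by
  have h1 : ∀ j, batchGrad F 1 z x N j = fderiv ℝ (objective π F) x
      + dyadicMean (fun i => centredGrad X π F x (z (N + i))) j := by
    intro j
    unfold batchGrad dyadicMean
    simp only [centredGrad_of_mem hx, stochGrad, Finset.sum_sub_distrib, Finset.sum_const,
      Nat.card_Icc, Nat.add_sub_cancel, Nat.cast_one, mul_one, smul_sub]
    rw [← Nat.cast_smul_eq_nsmul ℝ, smul_smul, Nat.cast_pow, Nat.cast_ofNat,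
      inv_mul_cancel₀ (by positivity), one_smul]
    abel
  unfold gradEstimator multilevel
  rw [h1, h1, h1, add_sub_add_left_eq_sub, add_assoc]

variable {Ω : Type*} [MeasurableSpace Ω]

theorem measurable_comp_nat {G : Type*} [MeasurableSpace G] {N : Ω → ℕ} (hN : Measurable N)
    {g : ℕ → Ω → G} (hg : ∀ n, Measurable (g n)) : Measurable fun a => g (N a) a := by
  have h1 : Measurable fun q : ℕ × Ω => g q.1 q.2 := measurable_from_prod_countable_right hg
  exact h1.comp (hN.prodMk measurable_id)

variable [FiniteDimensional ℝ E]

theorem measurable_dyadicMean {h : Ω → ℕ → E →L[ℝ] ℝ} (hh : ∀ i, Measurable fun a => h a i)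
    (j : ℕ) : Measurable fun a => dyadicMean (h a) j := by
  have h1 : Measurable fun a => ∑ i ∈ Finset.Icc 1 (2 ^ j), h a i :=
    Finset.measurable_sum _ fun i _ => hh i
  exact h1.const_smul ((2 : ℝ) ^ j)⁻¹

theorem measurable_multilevel {h : Ω → ℕ → E →L[ℝ] ℝ} (hh : ∀ i, Measurable fun a => h a i)
    {J : Ω → ℕ} (hJ : Measurable J) : Measurable fun a => multilevel (h a) M (J a) := by
  refine measurable_comp_nat hJ (g := fun n a => multilevel (h a) M n) fun n => ?_
  unfold multilevel
  split_ifs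
  · have h1 : Measurable fun a => dyadicMean (h a) n - dyadicMean (h a) (n - 1) :=
      (measurable_dyadicMean hh _).sub (measurable_dyadicMean hh _)
    exact (measurable_dyadicMean hh _).add (h1.const_smul ((2 : ℝ) ^ n))
  · exact (measurable_dyadicMean hh _).add_const _

variable [MeasurableSpace E] [BorelSpace E] {L σ : ℝ}

theorem measurable_noise (hX : IsClosed X) (hf : IsSmoothOn X L (objective π F))
    (hFm : Measurable (Function.uncurry F)) (hF : IsBoundedNoiseOracle X π F σ) {x : Ω → E}
    (hx : Measurable x) {N : Ω → ℕ} (hN : Measurable N) {Z : Ω → ℕ → S}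
    (hZ : ∀ i, Measurable fun a => Z a i) (i : ℕ) :
    Measurable fun a => centredGrad X π F (x a) (Z a (N a + i)) :=
  (measurable_centredGrad hX hf hFm hF).comp
    (hx.prodMk (measurable_comp_nat hN (g := fun n a => Z a (n + i)) fun _ => hZ _))

theorem measurable_xg {s : Ω → State E} (h1 : Measurable fun a => (s a).x)
    (h2 : Measurable fun a => (s a).xf) (b : ℝ) : Measurable fun a => (s a).xg b :=
  (h1.const_smul _).add (h2.const_smul _)

theorem measurable_run (hd : IsDistanceGenerating X ω ω') (hX : IsCompact X) (hβ : ∀ t, 1 ≤ β t)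
    (hx₀ : x₀ ∈ X) (hf : IsSmoothOn X L (objective π F)) (hFm : Measurable (Function.uncurry F))
    (hF : IsBoundedNoiseOracle X π F σ) {Z : Ω → ℕ → S} (hZ : ∀ i, Measurable fun a => Z a i)
    {J : Ω → ℕ → ℕ} (hJ : ∀ i, Measurable fun a => J a i) (t : ℕ) :
    Measurable (fun a => (run X ω ω' F β γ M 1 x₀ (Z a) (J a) t).x) ∧
      Measurable (fun a => (run X ω ω' F β γ M 1 x₀ (Z a) (J a) t).xf) ∧
      Measurable (fun a => (run X ω ω' F β γ M 1 x₀ (Z a) (J a) t).N) := by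
  induction t with
  | zero => exact ⟨measurable_const, measurable_const, measurable_const⟩
  | succ t ih =>
    obtain ⟨h1, h2, h3⟩ := ih
    have hxg := measurable_xg h1 h2 (β t)
    have hg : Measurable fun a => gradEstimator F M 1 (Z a)
        ((run X ω ω' F β γ M 1 x₀ (Z a) (J a) t).xg (β t))
        (run X ω ω' F β γ M 1 x₀ (Z a) (J a) t).N (J a t) := by
      simp only [fun a => gradEstimator_eq (M := M) (F := F) (π := π)
        (run_xg_mem (F := F) (γ := γ) (M := M) hd hX hβ hx₀ (Z a) (J a) t) (Z a)
        (run X ω ω' F β γ M 1 x₀ (Z a) (J a) t).N (J a t)]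
      exact (measurable_comp_of_continuousOn hX.isClosed hf.continuousOn_fderiv hxg
        fun a => run_xg_mem hd hX hβ hx₀ (Z a) (J a) t).add
        (measurable_multilevel (fun i => measurable_noise hX.isClosed hf hFm hF hxg h3 hZ i)
          (hJ t))
    have hx := measurable_prox hd hX h1 (fun a => (run_mem hd hX hβ hx₀ (Z a) (J a) t).1)
      (hg.const_smul (γ t))
    refine ⟨hx, (hx.const_smul _).add (h2.const_smul _), h3.add ?_⟩
    exact measurable_comp_nat (hJ t) (g := fun n _ => 2 ^ n * 1) fun n => measurable_const

end Iterates

/-! ### Averaging over the batch-size exponents -/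

section Exponents

variable {Ω S : Type*} [MeasurableSpace Ω] [MeasurableSpace S] {μ : Measure Ω}

theorem IsIIDGeometricHalf.measurableSet_eq {J : ℕ → Ω → ℕ} (hJ : IsIIDGeometricHalf μ J)
    (t i : ℕ) : MeasurableSet {a | J t a = i} := hJ.measurable t (measurableSet_singleton i)

variable [IsProbabilityMeasure μ]

theorem sum_range_half_pow_succ (n : ℕ) :
    ∑ i ∈ Finset.range n, (1 / 2 : ℝ) ^ (i + 1) = 1 - (1 / 2 : ℝ) ^ n := by
  induction n with
  | zero => simp
  | succ n ih =>
    rw [Finset.sum_range_succ, ih]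
    ring

/-- The masses 2^{-j} prescribed for j ≥ 1 already sum to 1, so nothing is left for the value 0. -/
theorem IsIIDGeometricHalf.ae_one_le {J : ℕ → Ω → ℕ} (hJ : IsIIDGeometricHalf μ J) (t : ℕ) :
    ∀ᵐ a ∂μ, 1 ≤ J t a := by
  have h1 : ∀ n : ℕ, μ.real {a | J t a = 0} ≤ (1 / 2 : ℝ) ^ n := by
    intro n
    have h2 : μ.real (⋃ i ∈ Finset.range (n + 1), {a | J t a = i})
        = ∑ i ∈ Finset.range (n + 1), μ.real {a | J t a = i} := by
      refine measureReal_biUnion_finset (fun i _ k _ hik => ?_)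
        fun i _ => hJ.measurableSet_eq t i
      refine Set.disjoint_left.2 fun a ha hb => hik ?_
      exact ha.symm.trans hb
    have h3 : ∑ i ∈ Finset.range (n + 1), μ.real {a | J t a = i} ≤ 1 :=
      h2 ▸ measureReal_le_one
    have h4 : ∑ i ∈ Finset.range n, μ.real {a | J t a = i + 1} = 1 - (1 / 2 : ℝ) ^ n := by
      rw [← sum_range_half_pow_succ]
      exact Finset.sum_congr rfl fun i _ => hJ.law t (i + 1) (by omega)
    rw [Finset.sum_range_succ', h4] at h3
    linarith
  have h5 : μ.real {a | J t a = 0} ≤ 0 :=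
    ge_of_tendsto' (tendsto_pow_atTop_nhds_zero_of_lt_one (by norm_num) (by norm_num)) h1
  have h6 : μ {a | J t a = 0} = 0 := by
    rw [← measureReal_eq_zero_iff]
    exact le_antisymm h5 measureReal_nonneg
  rw [ae_iff]
  convert h6 using 3
  ext a
  simp

/-- Almost surely, a function of a truncated exponent is a finite combination of indicators. -/
theorem IsIIDGeometricHalf.ite_ae_eq_sum {J : ℕ → Ω → ℕ} (hJ : IsIIDGeometricHalf μ J) (t : ℕ)
    {M : ℕ} (hM : 1 ≤ M) (g : ℕ → Ω → ℝ) :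
    (fun a => if 2 ^ J t a ≤ M then g (J t a) a else 0) =ᵐ[μ] fun a =>
      ∑ i ∈ Finset.Icc 1 (Nat.log 2 M), {a | J t a = i}.indicator (g i) a := by
  filter_upwards [hJ.ae_one_le t] with a ha
  have h1 : 2 ^ J t a ≤ M ↔ J t a ∈ Finset.Icc 1 (Nat.log 2 M) := by
    rw [Finset.mem_Icc, Nat.le_log_iff_pow_le (by norm_num) (by omega)]
    tauto
  simp only [Set.indicator_apply, Set.mem_ofPred_eq, h1, Finset.sum_ite_eq]

/-- Each of the ⌊log₂ M⌋ admissible levels contributes 2^j · 2^{-j} = 1. -/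
theorem IsIIDGeometricHalf.integral_ite_two_pow {J : ℕ → Ω → ℕ} (hJ : IsIIDGeometricHalf μ J)
    (t : ℕ) {M : ℕ} (hM : 1 ≤ M) :
    Integrable (fun a => if 2 ^ J t a ≤ M then (2 : ℝ) ^ J t a else 0) μ ∧
      ∫ a, (if 2 ^ J t a ≤ M then (2 : ℝ) ^ J t a else 0) ∂μ = Nat.log 2 M := by
  have h1 := hJ.ite_ae_eq_sum t hM fun i _ => (2 : ℝ) ^ i
  have h2 : ∀ i ∈ Finset.Icc 1 (Nat.log 2 M),
      Integrable ({a | J t a = i}.indicator fun _ => (2 : ℝ) ^ i) μ := fun i _ =>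
    (integrable_const _).indicator (hJ.measurableSet_eq t i)
  refine ⟨(integrable_finsetSum _ h2).congr h1.symm, ?_⟩
  rw [integral_congr_ae h1, integral_finsetSum _ h2]
  have h3 : ∀ i ∈ Finset.Icc 1 (Nat.log 2 M),
      ∫ a, {a | J t a = i}.indicator (fun _ => (2 : ℝ) ^ i) a ∂μ = 1 := by
    intro i hi
    rw [integral_indicator (hJ.measurableSet_eq t i), setIntegral_const,
      hJ.law t i (Finset.mem_Icc.1 hi).1, smul_eq_mul, ← mul_pow]
    norm_num
  rw [Finset.sum_congr rfl h3]
  simp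

/-- Fubini's theorem for a function of two independent sequences, integrating first over `Z`. -/
theorem integral_prod_indep {G H : Type*} [MeasurableSpace G] [MeasurableSpace H] {Z : Ω → G}
    {J : Ω → H} (hZ : Measurable Z) (hJ : Measurable J) (hZJ : IndepFun Z J μ) {φ : G → H → ℝ}
    (hφ : Measurable (Function.uncurry φ)) {b : ℝ} (hb : ∀ z j, |φ z j| ≤ b) :
    Integrable (fun a' => ∫ a, φ (Z a) (J a') ∂μ) μ ∧
      ∫ a, φ (Z a) (J a) ∂μ = ∫ a', ∫ a, φ (Z a) (J a') ∂μ ∂μ ∧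
      ∫ a, φ (Z a) (J a) ∂μ = ∫ a, ∫ a', φ (Z a) (J a') ∂μ ∂μ := by
  have h1 := (indepFun_iff_map_prod_eq_prod_map_map hZ.aemeasurable hJ.aemeasurable).1 hZJ
  have := Measure.isProbabilityMeasure_map (μ := μ) hZ.aemeasurable
  have := Measure.isProbabilityMeasure_map (μ := μ) hJ.aemeasurable
  have hint : Integrable (Function.uncurry φ) ((μ.map Z).prod (μ.map J)) :=
    Integrable.of_bound hφ.aestronglyMeasurable b (ae_of_all _ fun p => hb p.1 p.2)
  have h2 : ∫ a, φ (Z a) (J a) ∂μ = ∫ p, Function.uncurry φ p ∂((μ.map Z).prod (μ.map J)) := by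
    rw [← h1, integral_map (hZ.prodMk hJ).aemeasurable hφ.aestronglyMeasurable]; rfl
  have h3 : ∀ j, ∫ z, φ z j ∂(μ.map Z) = ∫ a, φ (Z a) j ∂μ := fun j =>
    integral_map hZ.aemeasurable (hφ.comp measurable_prodMk_right).aestronglyMeasurable
  have h4 : ∀ z, ∫ j, φ z j ∂(μ.map J) = ∫ a, φ z (J a) ∂μ := fun z =>
    integral_map hJ.aemeasurable (hφ.comp measurable_prodMk_left).aestronglyMeasurable
  have h5 := hint.integral_prod_right
  have h6 := hint.integral_prod_left
  simp only [Function.uncurry_apply_pair, h3, h4] at h5 h6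
  refine ⟨h5.comp_measurable hJ, ?_, ?_⟩
  · rw [h2, integral_prod_symm _ hint]
    simp only [Function.uncurry_apply_pair, h3]
    exact integral_map hJ.aemeasurable h5.aestronglyMeasurable
  · rw [h2, integral_prod _ hint]
    simp only [Function.uncurry_apply_pair, h4]
    exact integral_map hZ.aemeasurable h6.aestronglyMeasurable

/-- The exponent of iteration `t` is independent of the samples and of the earlier exponents. -/
theorem IsIIDGeometricHalf.setIntegral_eq {Z : ℕ → Ω → S} {J : ℕ → Ω → ℕ}
    (hJ : IsIIDGeometricHalf μ J) (hZ : ∀ t, Measurable (Z t))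
    (hZJ : IndepFun (fun a t => Z t a) (fun a t => J t a) μ) {Y : (ℕ → S) → (ℕ → ℕ) → ℝ}
    (hY : Measurable (Function.uncurry Y)) {b : ℝ} (hb : ∀ z j, |Y z j| ≤ b) {t : ℕ}
    (hYt : ∀ z j j', (∀ i < t, j i = j' i) → Y z j = Y z j') {i : ℕ} (hi : 1 ≤ i) :
    ∫ a, {a | J t a = i}.indicator (fun a => Y (fun s => Z s a) fun s => J s a) a ∂μ
      = (1 / 2 : ℝ) ^ i * ∫ a, Y (fun s => Z s a) (fun s => J s a) ∂μ := by
  classical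
  have hZm : Measurable fun a => fun s => Z s a := measurable_pi_lambda _ hZ
  have hJm : Measurable fun a => fun s => J s a := measurable_pi_lambda _ hJ.measurable
  have hset : MeasurableSet {j : ℕ → ℕ | j t = i} :=
    measurableSet_eq_fun (measurable_pi_apply t) measurable_const
  have h1 := (integral_prod_indep hZm hJm hZJ
    (φ := fun z j => {j : ℕ → ℕ | j t = i}.indicator (fun j => Y z j) j) (b := b) ?_ ?_).2.2
  · rw [(integral_prod_indep hZm hJm hZJ hY hb).2.2, ← integral_const_mul]
    simp only [Set.indicator_apply, Set.mem_ofPred_eq] at h1 ⊢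
    rw [h1]
    congr 1
    funext a
    set z := fun s => Z s a
    have hind : IndepFun (fun a' => ({i} : Set ℕ).indicator (fun _ => (1 : ℝ)) (J t a'))
        (fun a' => Y z fun s => J s a') μ := by
      have h2 := (hJ.indep.indepFun_finset {t} (Finset.range t) (by simp) hJ.measurable)
      have hφ : Measurable fun q : ↥({t} : Finset ℕ) → ℕ =>
          ({i} : Set ℕ).indicator (fun _ => (1 : ℝ)) (q ⟨t, by simp⟩) :=
        (measurable_const.indicator (measurableSet_singleton i)).comp (measurable_pi_apply _)
      -- The exponents from t on are filled in with 0. By `hYt` this does not change Y, which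
      -- becomes a function of the first t exponents and so, for fixed samples, independent of J_t.
      have hψ : Measurable fun q : ↥(Finset.range t) → ℕ =>
          Y z fun s => if h : s < t then q ⟨s, by simpa using h⟩ else 0 := by
        have hext : Measurable fun (q : ↥(Finset.range t) → ℕ) (s : ℕ) =>
            if h : s < t then q ⟨s, by simpa using h⟩ else 0 := by
          refine measurable_pi_iff.2 fun s => ?_
          by_cases h : s < t
          · simp only [dif_pos h]
            exact measurable_pi_apply _
          · simp only [dif_neg h]
            exact measurable_const
        exact (hY.comp measurable_prodMk_left).comp hext
      have h3 : (fun a' => Y z fun s => J s a')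
          = fun a' => Y z fun s => if s < t then J s a' else 0 :=
        funext fun a' => hYt z _ _ fun k hk => by simp [hk]
      rw [h3]
      exact h2.comp hφ hψ
    have h4 := hind.integral_mul_eq_mul_integral
      (((measurable_const.indicator (measurableSet_singleton i)).comp
        (hJ.measurable t)).aestronglyMeasurable)
      ((hY.comp measurable_prodMk_left).comp hJm).aestronglyMeasurable
    have h5 : ∫ a', ({i} : Set ℕ).indicator (fun _ => (1 : ℝ)) (J t a') ∂μ = (1 / 2 : ℝ) ^ i := by
      have h6 : (fun a' => ({i} : Set ℕ).indicator (fun _ => (1 : ℝ)) (J t a'))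
          = {a | J t a = i}.indicator fun _ => 1 := by
        funext a'; simp [Set.indicator_apply]
      rw [h6, integral_indicator (hJ.measurableSet_eq t i), setIntegral_const, hJ.law t i hi]
      simp
    rw [h5] at h4
    rw [← h4]
    congr 1
    funext a'
    simp [Set.indicator_apply]
  · refine Measurable.indicator hY (measurable_snd hset)
  · intro z j
    rw [Set.indicator_apply]
    split_ifs
    · exact hb z j
    · simpa using (abs_nonneg _).trans (hb z j)

end Exponents

/-! ### Expected noise and expected bias of one iteration -/

section Expectation

theorem norm_dyadicMean_le {E : Type*} [NormedAddCommGroup E] [NormedSpace ℝ E]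
    {h : ℕ → E →L[ℝ] ℝ} {b : ℝ} (hh : ∀ i, ‖h i‖ ≤ b) (k : ℕ) :
    ‖dyadicMean h k‖ ≤ b := by
  have h1 : ‖∑ i ∈ Finset.Icc 1 (2 ^ k), h i‖ ≤ (2 : ℝ) ^ k * b := by
    refine (norm_sum_le_of_le _ fun i _ => hh i).trans ?_
    simp
  rw [dyadicMean, norm_smul, norm_inv, norm_pow, Real.norm_ofNat]
  rw [inv_mul_le_iff₀ (by positivity)]
  exact h1

variable {E S Ω : Type*} [NormedAddCommGroup E] [NormedSpace ℝ E] [MeasurableSpace S]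
  [MeasurableSpace Ω] [MeasurableSpace E]

/-- The standing assumptions: a smooth convex stochastic problem on a compact set, sampled along a
uniformly ergodic chain, with independent batch-size exponents. -/
structure IsMarkovianProblem (μ : Measure Ω) (P : Kernel S S) (π : Measure S) (C₀ τ : ℝ)
    (Z : ℕ → Ω → S) (J : ℕ → Ω → ℕ) (X : Set E) (ω : E → ℝ) (ω' : E → E →L[ℝ] ℝ) (D : ℝ)
    (F : E → S → ℝ) (L σ : ℝ) : Prop where
  one_le_mixing : 1 ≤ τ
  ergodic : IsUniformlyErgodic P π C₀ τ
  chain : IsMarkovChain μ P Z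
  exponents : IsIIDGeometricHalf μ J
  indep : IndepFun (fun a t => Z t a) (fun a t => J t a) μ
  compact : IsCompact X
  distGen : IsDistanceGenerating X ω ω'
  diam_nonneg : 0 ≤ D
  bregman_le : ∀ x ∈ X, ∀ y ∈ X, bregman ω ω' x y ≤ D ^ 2
  measurable_loss : Measurable (Function.uncurry F)
  smoothness_pos : 0 < L
  smooth : IsSmoothOn X L (objective π F)
  convex : ConvexOn ℝ X (objective π F)
  noise_nonneg : 0 ≤ σ
  oracle : IsBoundedNoiseOracle X π F σ

/-- The noise of the `i`-th stochastic gradient of iteration `t`. -/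
def noiseSeq (X : Set E) (π : Measure S) (ω : E → ℝ) (ω' : E → E →L[ℝ] ℝ) (F : E → S → ℝ)
    (β γ : ℕ → ℝ) (M : ℕ) (x₀ : E) (z : ℕ → S) (j : ℕ → ℕ) (t i : ℕ) : E →L[ℝ] ℝ :=
  centredGrad X π F ((run X ω ω' F β γ M 1 x₀ z j t).xg (β t)) (z (sampleCount j t + i))

variable {μ : Measure Ω} {P : Kernel S S} {π : Measure S} {C₀ τ : ℝ}
  {Z : ℕ → Ω → S} {J : ℕ → Ω → ℕ} {X : Set E} {ω : E → ℝ} {ω' : E → E →L[ℝ] ℝ} {D : ℝ}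
  {F : E → S → ℝ} {L σ : ℝ} {β γ : ℕ → ℝ} {M : ℕ} {x₀ : E}

/-! ### Bounds and measurability for the noise along the run -/

namespace IsMarkovianProblem

theorem norm_sub_le (h : IsMarkovianProblem μ P π C₀ τ Z J X ω ω' D F L σ) {x y : E} (hx : x ∈ X)
    (hy : y ∈ X) : ‖x - y‖ ≤ 2 * D := by
  have h1 := h.distGen.half_sq_le_bregman hx hy
  have h2 := h.bregman_le x hx y hy
  have h3 := h.diam_nonneg
  nlinarith [norm_nonneg (x - y), sq_nonneg D]

theorem norm_noiseSeq_le (h : IsMarkovianProblem μ P π C₀ τ Z J X ω ω' D F L σ) (z : ℕ → S)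
    (j : ℕ → ℕ) (t i : ℕ) : ‖noiseSeq X π ω ω' F β γ M x₀ z j t i‖ ≤ σ :=
  norm_centredGrad_le h.noise_nonneg h.oracle _ _

theorem measurable_samples (h : IsMarkovianProblem μ P π C₀ τ Z J X ω ω' D F L σ) :
    Measurable fun a => fun i => Z i a := measurable_pi_lambda _ h.chain.measurable

theorem measurable_exponents (h : IsMarkovianProblem μ P π C₀ τ Z J X ω ω' D F L σ) :
    Measurable fun a => fun i => J i a := measurable_pi_lambda _ h.exponents.measurable

theorem abs_conjBound_noiseSeq_le (h : IsMarkovianProblem μ P π C₀ τ Z J X ω ω' D F L σ)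
    (hβ : ∀ t, 1 ≤ β t) (hx₀ : x₀ ∈ X) (t : ℕ) (c : ℝ) (n : ℕ) (z : ℕ → S) (j : ℕ → ℕ) :
    |conjBound X ω ω' (run X ω ω' F β γ M 1 x₀ z j t).x
      (fun i => c • noiseSeq X π ω ω' F β γ M x₀ z j t i) n| ≤ (n : ℝ) ^ 2 * (|c| * σ) ^ 2 := by
  refine abs_conjBound_le h.distGen h.compact (run_mem h.distGen h.compact hβ hx₀ z j t).1
    (fun i => ?_) n
  rw [norm_smul, Real.norm_eq_abs]
  exact mul_le_mul_of_nonneg_left (h.norm_noiseSeq_le _ _ _ _) (abs_nonneg _)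

theorem abs_dyadicMean_noiseSeq_le (h : IsMarkovianProblem μ P π C₀ τ Z J X ω ω' D F L σ)
    (hβ : ∀ t, 1 ≤ β t) (hx₀ : x₀ ∈ X) {u : E} (hu : u ∈ X) (t i : ℕ) (z : ℕ → S) (j : ℕ → ℕ) :
    |dyadicMean (noiseSeq X π ω ω' F β γ M x₀ z j t) i (u - (run X ω ω' F β γ M 1 x₀ z j t).x)|
      ≤ σ * (2 * D) := by
  rw [← Real.norm_eq_abs]
  exact (ContinuousLinearMap.le_opNorm _ _).trans
    (mul_le_mul (norm_dyadicMean_le (h.norm_noiseSeq_le z j t) i)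
      (h.norm_sub_le hu (run_mem h.distGen h.compact hβ hx₀ z j t).1) (norm_nonneg _)
      h.noise_nonneg)

variable [FiniteDimensional ℝ E] [BorelSpace E]

theorem measurable_x (h : IsMarkovianProblem μ P π C₀ τ Z J X ω ω' D F L σ)
    (hβ : ∀ t, 1 ≤ β t) (hx₀ : x₀ ∈ X) (t : ℕ) :
    Measurable fun q : (ℕ → S) × (ℕ → ℕ) => (run X ω ω' F β γ M 1 x₀ q.1 q.2 t).x :=
  (measurable_run h.distGen h.compact hβ hx₀ h.smooth h.measurable_loss h.oracle
    (fun i => (measurable_pi_apply i).comp measurable_fst)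
    (fun i => (measurable_pi_apply i).comp measurable_snd) t).1

theorem measurable_xf (h : IsMarkovianProblem μ P π C₀ τ Z J X ω ω' D F L σ)
    (hβ : ∀ t, 1 ≤ β t) (hx₀ : x₀ ∈ X) (t : ℕ) :
    Measurable fun q : (ℕ → S) × (ℕ → ℕ) => (run X ω ω' F β γ M 1 x₀ q.1 q.2 t).xf :=
  (measurable_run h.distGen h.compact hβ hx₀ h.smooth h.measurable_loss h.oracle
    (fun i => (measurable_pi_apply i).comp measurable_fst)
    (fun i => (measurable_pi_apply i).comp measurable_snd) t).2.1

theorem measurable_noiseSeq (h : IsMarkovianProblem μ P π C₀ τ Z J X ω ω' D F L σ)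
    (hβ : ∀ t, 1 ≤ β t) (hx₀ : x₀ ∈ X) (t i : ℕ) :
    Measurable fun q : (ℕ → S) × (ℕ → ℕ) => noiseSeq X π ω ω' F β γ M x₀ q.1 q.2 t i := by
  have hN : Measurable fun q : (ℕ → S) × (ℕ → ℕ) => sampleCount q.2 t := by
    refine Finset.measurable_sum _ fun i _ => ?_
    exact measurable_comp_nat ((measurable_pi_apply i).comp measurable_snd)
      (g := fun n _ => 2 ^ n) fun n => measurable_const
  exact measurable_noise h.compact.isClosed h.smooth h.measurable_loss h.oracle
    (measurable_xg (h.measurable_x hβ hx₀ t) (h.measurable_xf hβ hx₀ t) (β t)) hN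
    (fun i => (measurable_pi_apply i).comp measurable_fst) i

theorem measurable_conjBound_noiseSeq (h : IsMarkovianProblem μ P π C₀ τ Z J X ω ω' D F L σ)
    (hβ : ∀ t, 1 ≤ β t) (hx₀ : x₀ ∈ X) (t : ℕ) (c : ℝ) (n : ℕ) :
    Measurable fun q : (ℕ → S) × (ℕ → ℕ) => conjBound X ω ω'
      (run X ω ω' F β γ M 1 x₀ q.1 q.2 t).x
      (fun i => c • noiseSeq X π ω ω' F β γ M x₀ q.1 q.2 t i) n :=
  measurable_conjBound h.distGen h.compact (h.measurable_x hβ hx₀ t)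
    (fun q => (run_mem h.distGen h.compact hβ hx₀ q.1 q.2 t).1)
    (fun i => (h.measurable_noiseSeq hβ hx₀ t i).const_smul c) n

theorem measurable_dyadicMean_noiseSeq (h : IsMarkovianProblem μ P π C₀ τ Z J X ω ω' D F L σ)
    (hβ : ∀ t, 1 ≤ β t) (hx₀ : x₀ ∈ X) (u : E) (t i : ℕ) :
    Measurable fun q : (ℕ → S) × (ℕ → ℕ) =>
      dyadicMean (noiseSeq X π ω ω' F β γ M x₀ q.1 q.2 t) i
        (u - (run X ω ω' F β γ M 1 x₀ q.1 q.2 t).x) :=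
  measurable_dual_apply (measurable_dyadicMean (fun i => h.measurable_noiseSeq hβ hx₀ t i) i)
    ((h.measurable_x hβ hx₀ t).const_sub u)

variable [IsProbabilityMeasure μ]

/-- In expectation the multilevel estimator has the bias of the longest batch. -/
theorem integral_multilevel_eq (h : IsMarkovianProblem μ P π C₀ τ Z J X ω ω' D F L σ)
    (hβ : ∀ t, 1 ≤ β t) (hx₀ : x₀ ∈ X) (hM : 1 ≤ M) {u : E} (hu : u ∈ X) (t : ℕ) :
    Integrable (fun a => multilevel
        (noiseSeq X π ω ω' F β γ M x₀ (fun i => Z i a) (fun i => J i a) t) M (J t a)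
        (u - (run X ω ω' F β γ M 1 x₀ (fun i => Z i a) (fun i => J i a) t).x)) μ ∧
      ∫ a, multilevel
        (noiseSeq X π ω ω' F β γ M x₀ (fun i => Z i a) (fun i => J i a) t) M (J t a)
        (u - (run X ω ω' F β γ M 1 x₀ (fun i => Z i a) (fun i => J i a) t).x) ∂μ
      = ∫ a, dyadicMean
        (noiseSeq X π ω ω' F β γ M x₀ (fun i => Z i a) (fun i => J i a) t) (Nat.log 2 M)
        (u - (run X ω ω' F β γ M 1 x₀ (fun i => Z i a) (fun i => J i a) t).x) ∂μ := by
  set Y : ℕ → (ℕ → S) → (ℕ → ℕ) → ℝ := fun i z j =>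
    dyadicMean (noiseSeq X π ω ω' F β γ M x₀ z j t) i (u - (run X ω ω' F β γ M 1 x₀ z j t).x)
    with hY
  have hYm : ∀ i, Measurable (Function.uncurry (Y i)) := fun i =>
    h.measurable_dyadicMean_noiseSeq hβ hx₀ u t i
  have hYb : ∀ i z j, |Y i z j| ≤ σ * (2 * D) := fun i z j =>
    h.abs_dyadicMean_noiseSeq_le hβ hx₀ hu t i z j
  have hYint : ∀ i, Integrable (fun a => Y i (fun s => Z s a) fun s => J s a) μ := fun i =>
    Integrable.of_bound ((hYm i).comp (h.measurable_samples.prodMk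
      h.measurable_exponents)).aestronglyMeasurable _ (ae_of_all _ fun a => hYb i _ _)
  have hYt : ∀ i z j j', (∀ k < t, j k = j' k) → Y i z j = Y i z j' := by
    intro i z j j' hj
    have e1 : sampleCount j t = sampleCount j' t :=
      Finset.sum_congr rfl fun k hk => by rw [hj k (Finset.mem_range.1 hk)]
    have e2 : noiseSeq X π ω ω' F β γ M x₀ z j t = noiseSeq X π ω ω' F β γ M x₀ z j' t := by
      funext k
      simp only [noiseSeq, run_congr_exponents z hj, e1]
    simp only [hY, run_congr_exponents z hj, e2]
  have hae := h.exponents.ite_ae_eq_sum t hM fun i a =>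
    (2 : ℝ) ^ i * (Y i (fun s => Z s a) (fun s => J s a)
      - Y (i - 1) (fun s => Z s a) fun s => J s a)
  have hterm_int : ∀ i ∈ Finset.Icc 1 (Nat.log 2 M), Integrable ({a | J t a = i}.indicator
      fun a => (2 : ℝ) ^ i * (Y i (fun s => Z s a) (fun s => J s a)
        - Y (i - 1) (fun s => Z s a) fun s => J s a)) μ := fun i _ =>
    (((hYint i).sub (hYint (i - 1))).const_mul _).indicator (h.exponents.measurableSet_eq t i)
  -- The weight 2^i cancels the probability of level i, so the levels telescope; g_0 supplies the
  -- missing initial term.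
  have hterm : ∀ i ∈ Finset.Icc 1 (Nat.log 2 M), ∫ a, {a | J t a = i}.indicator
      (fun a => (2 : ℝ) ^ i * (Y i (fun s => Z s a) (fun s => J s a)
        - Y (i - 1) (fun s => Z s a) fun s => J s a)) a ∂μ
      = ∫ a, Y i (fun s => Z s a) (fun s => J s a) ∂μ
        - ∫ a, Y (i - 1) (fun s => Z s a) (fun s => J s a) ∂μ := by
    intro i hi
    have hi1 := (Finset.mem_Icc.1 hi).1
    have e : ({a | J t a = i}.indicator fun a => (2 : ℝ) ^ i * (Y i (fun s => Z s a)
        (fun s => J s a) - Y (i - 1) (fun s => Z s a) fun s => J s a))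
        = fun a => (2 : ℝ) ^ i * ({a | J t a = i}.indicator
          (fun a => Y i (fun s => Z s a) fun s => J s a) a
          - {a | J t a = i}.indicator
          (fun a => Y (i - 1) (fun s => Z s a) fun s => J s a) a) := by
      funext a
      simp only [Set.indicator_apply]
      split_ifs <;> simp
    rw [e, integral_const_mul, integral_sub
      ((hYint i).indicator (h.exponents.measurableSet_eq t i))
      ((hYint (i - 1)).indicator (h.exponents.measurableSet_eq t i)),
      h.exponents.setIntegral_eq h.chain.measurable h.indep (hYm i) (hYb i) (hYt i) hi1,
      h.exponents.setIntegral_eq h.chain.measurable h.indep (hYm (i - 1)) (hYb (i - 1))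
        (hYt (i - 1)) hi1, ← mul_sub, ← mul_assoc, ← mul_pow]
    norm_num
  have hsplit : (fun a => multilevel
      (noiseSeq X π ω ω' F β γ M x₀ (fun i => Z i a) (fun i => J i a) t) M (J t a)
      (u - (run X ω ω' F β γ M 1 x₀ (fun i => Z i a) (fun i => J i a) t).x))
      = fun a => Y 0 (fun s => Z s a) (fun s => J s a)
        + if 2 ^ J t a ≤ M then (2 : ℝ) ^ J t a * (Y (J t a) (fun s => Z s a) (fun s => J s a)
          - Y (J t a - 1) (fun s => Z s a) fun s => J s a) else 0 := by
    funext a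
    simp only [hY, multilevel, add_apply]
    split_ifs
    · simp [sub_apply]
    · simp
  have hite_int := (integrable_finsetSum _ hterm_int).congr hae.symm
  rw [hsplit]
  refine ⟨(hYint 0).add hite_int, ?_⟩
  rw [integral_add (hYint 0) hite_int, integral_congr_ae hae, integral_finsetSum _ hterm_int,
    Finset.sum_congr rfl hterm]
  have htel : ∀ n, ∑ i ∈ Finset.Icc 1 n, (∫ a, Y i (fun s => Z s a) (fun s => J s a) ∂μ
        - ∫ a, Y (i - 1) (fun s => Z s a) (fun s => J s a) ∂μ)
      = ∫ a, Y n (fun s => Z s a) (fun s => J s a) ∂μ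
        - ∫ a, Y 0 (fun s => Z s a) (fun s => J s a) ∂μ := by
    intro n
    induction n with
    | zero => simp
    | succ n ih =>
      rw [Finset.sum_Icc_succ_top (by omega), ih, Nat.add_sub_cancel]
      ring
  rw [htel]
  ring

variable [IsMarkovKernel P] [IsProbabilityMeasure π]

/-- The exponents j are frozen, so the batch begins after the deterministic index `sampleCount j t`
and the decoupling estimate applies with that index as N. -/
theorem integral_conjBound_noiseSeq_le (h : IsMarkovianProblem μ P π C₀ τ Z J X ω ω' D F L σ)
    (hβ : ∀ t, 1 ≤ β t) (hx₀ : x₀ ∈ X) (t : ℕ) (c : ℝ) (n : ℕ) (j : ℕ → ℕ) :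
    ∫ a, conjBound X ω ω' (run X ω ω' F β γ M 1 x₀ (fun i => Z i a) j t).x
        (fun i => c • noiseSeq X π ω ω' F β γ M x₀ (fun i => Z i a) j t i) n ∂μ
      ≤ c ^ 2 * σ ^ 2 * n * τ * (1 + 4 * |C₀|) := by
  have hj : Measurable fun z : ℕ → S => (z, j) := measurable_prodMk_right
  have hx := (h.measurable_x (γ := γ) (M := M) hβ hx₀ t).comp hj
  have hxf := (h.measurable_xf (γ := γ) (M := M) hβ hx₀ t).comp hj
  exact integral_conjBound_le h.one_le_mixing h.ergodic h.chain h.distGen h.compact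
    (measurable_centredGrad h.compact.isClosed h.smooth h.measurable_loss h.oracle)
    (norm_centredGrad_le h.noise_nonneg h.oracle)
    (integral_centredGrad_apply h.compact.isClosed h.smooth h.measurable_loss h.noise_nonneg
      h.oracle)
    (x := fun z => (run X ω ω' F β γ M 1 x₀ z j t).x)
    (y := fun z => (run X ω ω' F β γ M 1 x₀ z j t).xg (β t)) hx (measurable_xg hx hxf (β t))
    (fun z => (run_mem h.distGen h.compact hβ hx₀ z j t).1) (N := sampleCount j t)
    (fun z => by rw [run_stopSeq]) (fun z => by rw [run_stopSeq]) c n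

/-- A batch of length 2^j costs a multiple of 2^j and is drawn with probability 2^{-j}, so the
variance grows only with the number of levels. The samples are integrated out first, for fixed
exponents. -/
theorem integral_noiseBound_le (h : IsMarkovianProblem μ P π C₀ τ Z J X ω ω' D F L σ)
    (hβ : ∀ t, 1 ≤ β t) (hx₀ : x₀ ∈ X) (hM : 1 ≤ M) (t : ℕ) (c : ℝ) :
    Integrable (fun a => noiseBound X ω ω'
        (run X ω ω' F β γ M 1 x₀ (fun i => Z i a) (fun i => J i a) t).x
        (noiseSeq X π ω ω' F β γ M x₀ (fun i => Z i a) (fun i => J i a) t) c M (J t a)) μ ∧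
      ∫ a, noiseBound X ω ω' (run X ω ω' F β γ M 1 x₀ (fun i => Z i a) (fun i => J i a) t).x
        (noiseSeq X π ω ω' F β γ M x₀ (fun i => Z i a) (fun i => J i a) t) c M (J t a) ∂μ
      ≤ 36 * c ^ 2 * σ ^ 2 * τ * (1 + 4 * |C₀|) * (1 + 5 * Nat.log 2 M) := by
  set κ := 1 + 4 * |C₀| with hκ
  have hκ0 : 0 ≤ κ := by positivity
  have hτ0 : 0 ≤ τ := by linarith [h.one_le_mixing]
  set φ : (ℕ → S) → (ℕ → ℕ) → ℝ := fun z j => noiseBound X ω ω'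
    (run X ω ω' F β γ M 1 x₀ z j t).x (noiseSeq X π ω ω' F β γ M x₀ z j t) c M (j t) with hφdef
  have hm := fun c n => h.measurable_conjBound_noiseSeq (γ := γ) (M := M) hβ hx₀ t c n
  have hφ : Measurable (Function.uncurry φ) := by
    refine measurable_comp_nat ((measurable_pi_apply t).comp measurable_snd)
      (g := fun k (q : (ℕ → S) × (ℕ → ℕ)) => noiseBound X ω ω'
        (run X ω ω' F β γ M 1 x₀ q.1 q.2 t).x (noiseSeq X π ω ω' F β γ M x₀ q.1 q.2 t) c M k)
      fun k => ?_
    unfold noiseBound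
    split_ifs
    · exact (hm _ _).add ((hm _ _).add (hm _ _))
    · exact (hm _ _).add measurable_const
  set b₁ : ℝ := (|-(6 * c)| * σ) ^ 2
  set b₂ : ℝ := (|12 * c| * σ) ^ 2
  have hb₁ : 0 ≤ b₁ := sq_nonneg _
  have hb₂ : 0 ≤ b₂ := sq_nonneg _
  have hb : ∀ z j, |φ z j| ≤ b₁ + ((M : ℝ) ^ 2 * b₁ + (M : ℝ) ^ 2 * b₂) := by
    intro z j
    have h0 := h.abs_conjBound_noiseSeq_le (γ := γ) (M := M) hβ hx₀ t (-(6 * c)) 1 z j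
    have h1 := h.abs_conjBound_noiseSeq_le (γ := γ) (M := M) hβ hx₀ t (-(6 * c)) (2 ^ j t) z j
    have h2 := h.abs_conjBound_noiseSeq_le (γ := γ) (M := M) hβ hx₀ t (12 * c) (2 ^ (j t - 1)) z j
    rw [Nat.cast_one, one_pow, one_mul] at h0
    simp only [hφdef, noiseBound]
    refine (abs_add_le _ _).trans (add_le_add h0 ?_)
    split_ifs with hjM
    · have h3 : ((2 ^ j t : ℕ) : ℝ) ≤ M := by exact_mod_cast hjM
      have h4 : ((2 ^ (j t - 1) : ℕ) : ℝ) ≤ M := by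
        refine le_trans ?_ h3
        exact_mod_cast Nat.pow_le_pow_right (by norm_num) (Nat.sub_le _ _)
      refine (abs_add_le _ _).trans (add_le_add (h1.trans ?_) (h2.trans ?_))
      · gcongr
      · gcongr
    · rw [abs_zero]; positivity
  have hint : Integrable (fun a => φ (fun i => Z i a) (fun i => J i a)) μ :=
    Integrable.of_bound (hφ.comp (h.measurable_samples.prodMk
      h.measurable_exponents)).aestronglyMeasurable _ (ae_of_all _ fun a => hb _ _)
  refine ⟨hint, ?_⟩
  obtain ⟨hi1, hi2, -⟩ := integral_prod_indep h.measurable_samples h.measurable_exponents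
    h.indep hφ hb
  have hinner : ∀ j : ℕ → ℕ, ∫ a, φ (fun i => Z i a) j ∂μ
      ≤ 36 * c ^ 2 * σ ^ 2 * τ * κ
        * (1 + 5 * if 2 ^ j t ≤ M then (2 : ℝ) ^ j t else 0) := by
    intro j
    have hintc : ∀ c n, Integrable (fun a => conjBound X ω ω'
        (run X ω ω' F β γ M 1 x₀ (fun i => Z i a) j t).x
        (fun i => c • noiseSeq X π ω ω' F β γ M x₀ (fun i => Z i a) j t i) n) μ := fun c n =>
      Integrable.of_bound ((hm c n).comp
        (h.measurable_samples.prodMk measurable_const)).aestronglyMeasurable _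
        (ae_of_all _ fun a => h.abs_conjBound_noiseSeq_le (γ := γ) (M := M) hβ hx₀ t c n _ j)
    have h0 := h.integral_conjBound_noiseSeq_le (γ := γ) (M := M) hβ hx₀ t (-(6 * c)) 1 j
    have h1 := h.integral_conjBound_noiseSeq_le (γ := γ) (M := M) hβ hx₀ t (-(6 * c)) (2 ^ j t) j
    have h2 := h.integral_conjBound_noiseSeq_le (γ := γ) (M := M) hβ hx₀ t (12 * c)
      (2 ^ (j t - 1)) j
    rw [← hκ] at h0 h1 h2
    simp only [hφdef, noiseBound]
    by_cases hjM : 2 ^ j t ≤ M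
    · simp only [if_pos hjM]
      have hsum := integral_add (hintc (-(6 * c)) 1)
        ((hintc (-(6 * c)) (2 ^ j t)).add (hintc (12 * c) (2 ^ (j t - 1))))
      have hsum' := integral_add (hintc (-(6 * c)) (2 ^ j t)) (hintc (12 * c) (2 ^ (j t - 1)))
      simp only [Pi.add_apply] at hsum
      rw [hsum, hsum']
      -- Bounding 2^{j-1} by 2^j covers j = 0, where the truncated subtraction gives equality. The
      -- two batches then cost (36 + 144) · 2^j = 36 · 5 · 2^j.
      have h3 : ((2 ^ (j t - 1) : ℕ) : ℝ) ≤ (2 : ℝ) ^ j t := by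
        exact_mod_cast Nat.pow_le_pow_right (by norm_num) (Nat.sub_le _ _)
      have h4 : (12 * c) ^ 2 * σ ^ 2 * ((2 ^ (j t - 1) : ℕ) : ℝ) * τ * κ
          ≤ (12 * c) ^ 2 * σ ^ 2 * (2 : ℝ) ^ j t * τ * κ := by gcongr
      push_cast at h0 h1 h2 h4 ⊢
      nlinarith
    · simp only [if_neg hjM, add_zero, mul_zero]
      push_cast at h0
      nlinarith
  obtain ⟨hg1, hg2⟩ := h.exponents.integral_ite_two_pow t hM
  calc ∫ a, φ (fun i => Z i a) (fun i => J i a) ∂μ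
      = ∫ a', ∫ a, φ (fun i => Z i a) (fun i => J i a') ∂μ ∂μ := hi2
    _ ≤ ∫ a', 36 * c ^ 2 * σ ^ 2 * τ * κ
        * (1 + 5 * if 2 ^ J t a' ≤ M then (2 : ℝ) ^ J t a' else 0) ∂μ :=
        integral_mono hi1 (((integrable_const _).add (hg1.const_mul 5)).const_mul _)
          fun a' => hinner _
    _ = 36 * c ^ 2 * σ ^ 2 * τ * κ * (1 + 5 * Nat.log 2 M) := by
        rw [integral_const_mul, integral_add (integrable_const _) (hg1.const_mul 5),
          integral_const_mul, hg2]
        simp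

/-- Fenchel–Young at scale s: s times the mean over the longest batch, paired with u - x, is at most
the conjugate bound plus V(x, u) ≤ D². Independence of the noise from u - x is not needed; the
parameter s is optimised later. -/
theorem integral_multilevel_le (h : IsMarkovianProblem μ P π C₀ τ Z J X ω ω' D F L σ)
    (hβ : ∀ t, 1 ≤ β t) (hx₀ : x₀ ∈ X) (hM : 1 ≤ M) {u : E} (hu : u ∈ X) (t : ℕ) {s : ℝ}
    (hs : 0 < s) :
    ∫ a, multilevel
        (noiseSeq X π ω ω' F β γ M x₀ (fun i => Z i a) (fun i => J i a) t) M (J t a)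
        (u - (run X ω ω' F β γ M 1 x₀ (fun i => Z i a) (fun i => J i a) t).x) ∂μ
      ≤ 2 * s * σ ^ 2 * τ * (1 + 4 * |C₀|) / M + D ^ 2 / s := by
  have hτ0 : 0 ≤ τ := by linarith [h.one_le_mixing]
  rw [(h.integral_multilevel_eq hβ hx₀ hM hu t).2]
  set k := Nat.log 2 M with hk
  -- With this weight the sum over the batch is s times its mean, and c² 2^k = s²/2^k, where 2^k ≥
  -- M/2 because k = ⌊log₂ M⌋.
  set c : ℝ := s * ((2 : ℝ) ^ k)⁻¹ with hc
  have hm := h.measurable_conjBound_noiseSeq (γ := γ) (M := M) hβ hx₀ t c (2 ^ k)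
  have hb := h.abs_conjBound_noiseSeq_le (γ := γ) (M := M) hβ hx₀ t c (2 ^ k)
  have hpm := h.measurable_samples.prodMk h.measurable_exponents
  have hint : Integrable (fun a => conjBound X ω ω'
      (run X ω ω' F β γ M 1 x₀ (fun i => Z i a) (fun i => J i a) t).x
      (fun i => c • noiseSeq X π ω ω' F β γ M x₀ (fun i => Z i a) (fun i => J i a) t i)
      (2 ^ k)) μ :=
    Integrable.of_bound (hm.comp hpm).aestronglyMeasurable _ (ae_of_all _ fun a => hb _ _)
  have hpt : ∀ a, dyadicMean
      (noiseSeq X π ω ω' F β γ M x₀ (fun i => Z i a) (fun i => J i a) t) k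
      (u - (run X ω ω' F β γ M 1 x₀ (fun i => Z i a) (fun i => J i a) t).x)
      ≤ s⁻¹ * (conjBound X ω ω'
        (run X ω ω' F β γ M 1 x₀ (fun i => Z i a) (fun i => J i a) t).x
        (fun i => c • noiseSeq X π ω ω' F β γ M x₀ (fun i => Z i a) (fun i => J i a) t i)
        (2 ^ k) + D ^ 2) := by
    intro a
    have hx := (run_mem (F := F) (γ := γ) (M := M) h.distGen h.compact hβ hx₀ (fun i => Z i a)
      (fun i => J i a) t).1
    have h1 := apply_sub_bregman_le_conjBound h.distGen h.compact hx (fun i =>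
      c • noiseSeq X π ω ω' F β γ M x₀ (fun i => Z i a) (fun i => J i a) t i) (2 ^ k) hu
    have h2 := h.bregman_le _ hx u hu
    rw [← Finset.smul_sum, hc, mul_smul, smul_apply, smul_eq_mul] at h1
    rw [le_inv_mul_iff₀ hs, dyadicMean]
    linarith
  have h3 := (integral_prod_indep h.measurable_samples h.measurable_exponents h.indep
    (φ := fun z j => conjBound X ω ω' (run X ω ω' F β γ M 1 x₀ z j t).x
      (fun i => c • noiseSeq X π ω ω' F β γ M x₀ z j t i) (2 ^ k)) hm hb)
  have h4 : ∫ a, conjBound X ω ω'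
      (run X ω ω' F β γ M 1 x₀ (fun i => Z i a) (fun i => J i a) t).x
      (fun i => c • noiseSeq X π ω ω' F β γ M x₀ (fun i => Z i a) (fun i => J i a) t i)
      (2 ^ k) ∂μ ≤ c ^ 2 * σ ^ 2 * (2 ^ k : ℕ) * τ * (1 + 4 * |C₀|) := by
    rw [h3.2.1]
    refine (integral_mono h3.1 (integrable_const _) fun a' =>
      h.integral_conjBound_noiseSeq_le hβ hx₀ t c (2 ^ k) _).trans ?_
    simp
  have hYint : Integrable (fun a => dyadicMean
      (noiseSeq X π ω ω' F β γ M x₀ (fun i => Z i a) (fun i => J i a) t) k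
      (u - (run X ω ω' F β γ M 1 x₀ (fun i => Z i a) (fun i => J i a) t).x)) μ :=
    Integrable.of_bound ((h.measurable_dyadicMean_noiseSeq hβ hx₀ u t k).comp
      hpm).aestronglyMeasurable _
      (ae_of_all _ fun a => h.abs_dyadicMean_noiseSeq_le hβ hx₀ hu t k _ _)
  refine (integral_mono hYint ((hint.add (integrable_const (D ^ 2))).const_mul _) hpt).trans ?_
  simp only [Pi.add_apply]
  rw [integral_const_mul, integral_add hint (integrable_const _)]
  simp only [integral_const, probReal_univ, one_smul]
  have hM0 : (0 : ℝ) < M := by exact_mod_cast hM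
  have h5 : (M : ℝ) ≤ 2 * 2 ^ k := by
    have := (Nat.lt_pow_succ_log_self (b := 2) (by norm_num) M).le
    rw [← hk, pow_succ'] at this
    exact_mod_cast this
  have h6 : s⁻¹ * (c ^ 2 * σ ^ 2 * (2 ^ k : ℕ) * τ * (1 + 4 * |C₀|))
      = s * σ ^ 2 * τ * (1 + 4 * |C₀|) * ((2 : ℝ) ^ k)⁻¹ := by
    rw [hc]
    push_cast
    field_simp
  have h7 : ((2 : ℝ) ^ k)⁻¹ ≤ 2 / M := by
    rw [inv_le_comm₀ (by positivity) (by positivity), inv_div, div_le_iff₀ (by norm_num)]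
    linarith
  rw [mul_add]
  refine add_le_add ?_ (le_of_eq (by rw [div_eq_inv_mul]))
  refine (mul_le_mul_of_nonneg_left h4 (by positivity)).trans ?_
  rw [h6]
  refine (mul_le_mul_of_nonneg_left h7 (by positivity)).trans (le_of_eq ?_)
  ring

end IsMarkovianProblem

end Expectation

/-! ### Convergence of the accelerated method -/

section Convergence

variable {E S Ω : Type*} [NormedAddCommGroup E] [NormedSpace ℝ E] [MeasurableSpace S]
  [MeasurableSpace Ω] [MeasurableSpace E] {μ : Measure Ω} {P : Kernel S S} {π : Measure S}
  {C₀ τ : ℝ} {Z : ℕ → Ω → S} {J : ℕ → Ω → ℕ} {X : Set E} {ω : E → ℝ} {ω' : E → E →L[ℝ] ℝ} {D : ℝ}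
  {F : E → S → ℝ} {L σ : ℝ} {M : ℕ} {x₀ : E}

theorem one_le_momentum (t : ℕ) : 1 ≤ momentum t := by
  unfold momentum
  have : (0 : ℝ) ≤ t := t.cast_nonneg
  linarith

namespace IsMarkovianProblem

theorem run_step_le (h : IsMarkovianProblem μ P π C₀ τ Z J X ω ω' D F L σ) (hx₀ : x₀ ∈ X)
    {g : ℝ} (hg : 0 ≤ g) (hgL : g * (2 * L) ≤ 1) {u : E} (hu : u ∈ X) (z : ℕ → S) {j : ℕ → ℕ}
    (hj : ∀ t, 1 ≤ j t) (t : ℕ) {γ : ℕ → ℝ} (hγ : ∀ t, γ t = momentum t * g) :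
    momentum t * γ t * (objective π F (run X ω ω' F momentum γ M 1 x₀ z j (t + 1)).xf
        - objective π F u) + bregman ω ω' (run X ω ω' F momentum γ M 1 x₀ z j (t + 1)).x u
      ≤ (momentum t - 1) * γ t * (objective π F (run X ω ω' F momentum γ M 1 x₀ z j t).xf
        - objective π F u) + bregman ω ω' (run X ω ω' F momentum γ M 1 x₀ z j t).x u
        + (1 / 6 * noiseBound X ω ω' (run X ω ω' F momentum γ M 1 x₀ z j t).x
          (noiseSeq X π ω ω' F momentum γ M x₀ z j t) (γ t) M (j t)
        + γ t * multilevel (noiseSeq X π ω ω' F momentum γ M x₀ z j t) M (j t)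
          (u - (run X ω ω' F momentum γ M 1 x₀ z j t).x)) := by
  have hβ := one_le_momentum
  have hmt := hβ t
  set s := run X ω ω' F momentum γ M 1 x₀ z j t with hs
  have hmem : s.x ∈ X ∧ s.xf ∈ X := run_mem h.distGen h.compact hβ hx₀ z j t
  have hxg : s.xg (momentum t) ∈ X := run_xg_mem h.distGen h.compact hβ hx₀ z j t
  have hγ0 : 0 ≤ γ t := by rw [hγ]; positivity
  have hγβ : γ t * (2 * L) ≤ momentum t := by
    rw [hγ, mul_assoc]
    nlinarith
  have hN : s.N = sampleCount j t := run_N z j t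
  have hest := gradEstimator_eq (M := M) (F := F) (π := π) hxg z s.N (j t)
  have hnoise : gradEstimator F M 1 z (s.xg (momentum t)) s.N (j t)
      - fderiv ℝ (objective π F) (s.xg (momentum t))
      = multilevel (noiseSeq X π ω ω' F momentum γ M x₀ z j t) M (j t) := by
    rw [hest, add_sub_cancel_left, hN]
    rfl
  have hx' := prox_mem h.distGen h.compact hmem.1
    (γ t • gradEstimator F M 1 z (s.xg (momentum t)) s.N (j t))
  have h1 := accelerated_step h.distGen h.compact h.smooth h.convex hmt hγ0 hγβ hmem.1 hmem.2 hu
    (gradEstimator F M 1 z (s.xg (momentum t)) s.N (j t)) rfl rfl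
  have h2 := noise_le_noiseBound h.distGen h.compact hmem.1 hx'
    (noiseSeq X π ω ω' F momentum γ M x₀ z j t) (γ t) M (hj t)
  have e : s.xg (momentum t) = (momentum t)⁻¹ • s.x + (1 - (momentum t)⁻¹) • s.xf := rfl
  rw [← e, hnoise] at h1
  exact h1.trans (by linarith)

/-- The step inequalities are summed; β_0 = 1 removes the initial gap, so only V(x₀, u) ≤ D² remains
from the start. -/
theorem run_potential_le (h : IsMarkovianProblem μ P π C₀ τ Z J X ω ω' D F L σ) (hx₀ : x₀ ∈ X)
    {g : ℝ} (hg : 0 ≤ g) (hgL : g * (2 * L) ≤ 1) {u : E} (hu : u ∈ X)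
    (hmin : ∀ y ∈ X, objective π F u ≤ objective π F y) (z : ℕ → S) {j : ℕ → ℕ}
    (hj : ∀ t, 1 ≤ j t) {γ : ℕ → ℝ} (hγ : ∀ t, γ t = momentum t * g) (T : ℕ) :
    (momentum T - 1) * γ T * (objective π F (run X ω ω' F momentum γ M 1 x₀ z j T).xf
        - objective π F u) + bregman ω ω' (run X ω ω' F momentum γ M 1 x₀ z j T).x u
      ≤ D ^ 2 + ∑ t ∈ Finset.range T,
        (1 / 6 * noiseBound X ω ω' (run X ω ω' F momentum γ M 1 x₀ z j t).x
          (noiseSeq X π ω ω' F momentum γ M x₀ z j t) (γ t) M (j t)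
        + γ t * multilevel (noiseSeq X π ω ω' F momentum γ M x₀ z j t) M (j t)
          (u - (run X ω ω' F momentum γ M 1 x₀ z j t).x)) := by
  induction T with
  | zero =>
    have := h.bregman_le x₀ hx₀ u hu
    simpa [momentum, run] using this
  | succ T ih =>
    rw [Finset.sum_range_succ]
    have h1 := h.run_step_le (M := M) hx₀ hg hgL hu z hj T hγ
    have h2 := hmin _ (run_mem (F := F) (γ := γ) (M := M) h.distGen h.compact one_le_momentum hx₀
      z j (T + 1)).2
    -- After division by g/4 this reads (T + 1)(T + 3) ≤ (T + 2)²; it chains the potentials because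
    -- the gap is nonnegative.
    have h3 : (momentum (T + 1) - 1) * γ (T + 1) ≤ momentum T * γ T := by
      rw [hγ, hγ]
      unfold momentum
      push_cast
      nlinarith
    have h4 := mul_le_mul_of_nonneg_right h3 (sub_nonneg.2 h2)
    linarith

variable [FiniteDimensional ℝ E] [BorelSpace E] [IsProbabilityMeasure μ]

theorem integrable_objective_xf (h : IsMarkovianProblem μ P π C₀ τ Z J X ω ω' D F L σ)
    (hx₀ : x₀ ∈ X) (γ : ℕ → ℝ) (T : ℕ) :
    Integrable (fun a => objective π F
      (run X ω ω' F momentum γ M 1 x₀ (fun t => Z t a) (fun t => J t a) T).xf) μ := by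
  have hc : ContinuousOn (objective π F) X := fun x hx =>
    (h.smooth.1 x hx).continuousAt.continuousWithinAt
  obtain ⟨b, hb⟩ := h.compact.exists_bound_of_continuousOn hc
  have hmem := fun a => (run_mem (F := F) (γ := γ) (M := M) h.distGen h.compact one_le_momentum hx₀
      (fun t => Z t a) (fun t => J t a) T).2
  have hm := (h.measurable_xf (γ := γ) (M := M) one_le_momentum hx₀ T).comp
    (h.measurable_samples.prodMk h.measurable_exponents)
  exact Integrable.of_bound (measurable_comp_of_continuousOn h.compact.isClosed hc hm
    hmem).aestronglyMeasurable b (ae_of_all _ fun a => hb _ (hmem a))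

variable [IsMarkovKernel P] [IsProbabilityMeasure π]

/-- The convergence guarantee with the free parameters `g` (the scale of the stepsizes) and `s`. -/
theorem integral_gap_le (h : IsMarkovianProblem μ P π C₀ τ Z J X ω ω' D F L σ) (hx₀ : x₀ ∈ X)
    {g : ℝ} (hg : 0 ≤ g) (hgL : g * (2 * L) ≤ 1) {u : E} (hu : u ∈ X)
    (hmin : ∀ y ∈ X, objective π F u ≤ objective π F y) {T : ℕ} (hT : 1 ≤ T) {γ : ℕ → ℝ}
    (hγ : ∀ t, γ t = momentum t * g) {s : ℝ} (hs : 0 < s) :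
    g * (T : ℝ) ^ 2 / 4 * (∫ a, (objective π F
        (run X ω ω' F momentum γ T 1 x₀ (fun t => Z t a) (fun t => J t a) T).xf
        - objective π F u) ∂μ)
      ≤ D ^ 2 + g ^ 2 * (T : ℝ) ^ 3 * (6 * σ ^ 2 * τ * (1 + 4 * |C₀|) * (1 + 5 * Nat.log 2 T))
        + g * (T : ℝ) ^ 2 * (2 * s * σ ^ 2 * τ * (1 + 4 * |C₀|) / T + D ^ 2 / s) := by
  set κ := 1 + 4 * |C₀| with hκ
  have hκ0 : 0 ≤ κ := by positivity
  have hτ0 : 0 ≤ τ := by linarith [h.one_le_mixing]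
  have hT0 : (1 : ℝ) ≤ T := by exact_mod_cast hT
  have hfin := (h.integrable_objective_xf (M := T) hx₀ γ T).sub
    (integrable_const (objective π F u))
  have hn := fun t => h.integral_noiseBound_le (γ := γ) one_le_momentum hx₀ hT t (γ t)
  have hbi := fun t => h.integral_multilevel_eq (γ := γ) one_le_momentum hx₀ hT hu t
  have hbl := fun t => h.integral_multilevel_le (γ := γ) one_le_momentum hx₀ hT hu t hs
  have hJ : ∀ᵐ a ∂μ, ∀ t, 1 ≤ J t a := ae_all_iff.2 h.exponents.ae_one_le
  have hpath : ∀ᵐ a ∂μ, g * (T : ℝ) ^ 2 / 4 * (objective π F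
      (run X ω ω' F momentum γ T 1 x₀ (fun t => Z t a) (fun t => J t a) T).xf
        - objective π F u)
      ≤ D ^ 2 + ∑ t ∈ Finset.range T, (1 / 6 * noiseBound X ω ω'
          (run X ω ω' F momentum γ T 1 x₀ (fun t => Z t a) (fun t => J t a) t).x
          (noiseSeq X π ω ω' F momentum γ T x₀ (fun t => Z t a) (fun t => J t a) t) (γ t) T (J t a)
        + γ t * multilevel
          (noiseSeq X π ω ω' F momentum γ T x₀ (fun t => Z t a) (fun t => J t a) t) T (J t a)
          (u - (run X ω ω' F momentum γ T 1 x₀ (fun t => Z t a) (fun t => J t a) t).x)) := by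
    filter_upwards [hJ] with a ha
    have hmem := run_mem (F := F) (γ := γ) (M := T) h.distGen h.compact one_le_momentum hx₀
      (fun t => Z t a) (fun t => J t a) T
    have h1 := h.run_potential_le (M := T) hx₀ hg hgL hu hmin (fun t => Z t a) ha hγ T
    have h2 := h.distGen.bregman_nonneg hmem.1 hu
    have h3 : g * (T : ℝ) ^ 2 / 4 ≤ (momentum T - 1) * γ T := by
      rw [hγ]
      unfold momentum
      nlinarith
    have h4 := mul_le_mul_of_nonneg_right h3 (sub_nonneg.2 (hmin _ hmem.2))
    linarith
  have hsum_int : ∀ t ∈ Finset.range T, Integrable (fun a => 1 / 6 * noiseBound X ω ω'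
          (run X ω ω' F momentum γ T 1 x₀ (fun t => Z t a) (fun t => J t a) t).x
          (noiseSeq X π ω ω' F momentum γ T x₀ (fun t => Z t a) (fun t => J t a) t) (γ t) T (J t a)
        + γ t * multilevel
          (noiseSeq X π ω ω' F momentum γ T x₀ (fun t => Z t a) (fun t => J t a) t) T (J t a)
          (u - (run X ω ω' F momentum γ T 1 x₀ (fun t => Z t a) (fun t => J t a) t).x)) μ :=
    fun t _ => ((hn t).1.const_mul _).add ((hbi t).1.const_mul _)
  rw [← integral_const_mul]
  refine (integral_mono_ae (hfin.const_mul _)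
    ((integrable_const (D ^ 2)).add (integrable_finsetSum _ hsum_int)) hpath).trans ?_
  simp only [Pi.add_apply]
  rw [integral_add (integrable_const _) (integrable_finsetSum _ hsum_int),
    integral_finsetSum _ hsum_int]
  simp only [integral_const, probReal_univ, one_smul]
  rw [add_assoc]
  refine add_le_add_right ?_ (D ^ 2)
  have hγ0 : ∀ t, 0 ≤ γ t := fun t => by
    rw [hγ]; exact mul_nonneg (by linarith [one_le_momentum t]) hg
  have hγT : ∀ t ∈ Finset.range T, γ t ≤ g * T := by
    intro t ht
    have h1 : (t : ℝ) + 1 ≤ T := by exact_mod_cast Finset.mem_range.1 ht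
    rw [hγ, mul_comm]
    refine mul_le_mul_of_nonneg_left ?_ hg
    unfold momentum
    linarith
  set B₁ := 6 * σ ^ 2 * τ * κ * (1 + 5 * (Nat.log 2 T : ℝ)) with hB₁
  set B₂ := 2 * s * σ ^ 2 * τ * κ / T + D ^ 2 / s with hB₂
  have hB₁0 : 0 ≤ B₁ := by positivity
  have hB₂0 : 0 ≤ B₂ := by positivity
  have hterm : ∀ t ∈ Finset.range T, ∫ a, (1 / 6 * noiseBound X ω ω'
          (run X ω ω' F momentum γ T 1 x₀ (fun t => Z t a) (fun t => J t a) t).x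
          (noiseSeq X π ω ω' F momentum γ T x₀ (fun t => Z t a) (fun t => J t a) t) (γ t) T (J t a)
        + γ t * multilevel
          (noiseSeq X π ω ω' F momentum γ T x₀ (fun t => Z t a) (fun t => J t a) t) T (J t a)
          (u - (run X ω ω' F momentum γ T 1 x₀ (fun t => Z t a) (fun t => J t a) t).x)) ∂μ
      ≤ (g * T) ^ 2 * B₁ + g * T * B₂ := by
    intro t ht
    rw [integral_add ((hn t).1.const_mul _) ((hbi t).1.const_mul _), integral_const_mul,
      integral_const_mul]
    have h1 := (hn t).2
    have h2 := mul_le_mul_of_nonneg_left (hbl t) (hγ0 t)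
    have h3 : γ t ^ 2 * B₁ ≤ (g * T) ^ 2 * B₁ := by
      have := hγ0 t
      have := hγT t ht
      gcongr
    have h4 : γ t * B₂ ≤ g * T * B₂ := mul_le_mul_of_nonneg_right (hγT t ht) hB₂0
    have h5 : 1 / 6 * (36 * γ t ^ 2 * σ ^ 2 * τ * (1 + 4 * |C₀|) * (1 + 5 * (Nat.log 2 T : ℝ)))
        = γ t ^ 2 * B₁ := by rw [hB₁]; ring
    have h6 := mul_le_mul_of_nonneg_left h1 (by norm_num : (0 : ℝ) ≤ 1 / 6)
    rw [h5] at h6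
    exact add_le_add (h6.trans h3) (h2.trans h4)
  refine (Finset.sum_le_sum hterm).trans (le_of_eq ?_)
  rw [Finset.sum_const, Finset.card_range, nsmul_eq_mul]
  ring

end IsMarkovianProblem

end Convergence

/-! ### Complexity estimates -/

section Rates

theorem natLog_two_le {T : ℕ} (hT : 1 ≤ T) : (Nat.log 2 T : ℝ) ≤ 2 * Real.log T := by
  have h1 : ((2 : ℝ) ^ Nat.log 2 T) ≤ T := by
    exact_mod_cast Nat.pow_log_le_self 2 (by omega)
  have h2 := Real.log_le_log (by positivity) h1
  rw [Real.log_pow] at h2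
  have h3 : (1 / 2 : ℝ) ≤ Real.log 2 := by linarith [Real.log_two_gt_d9]
  nlinarith [(Nat.log 2 T).cast_nonneg (α := ℝ)]

/-- The common factor `min {1/(2L), D/(T^{3/2} σ τ^{1/2})}` of the stepsizes. -/
def stepScale (L D σ τ : ℝ) (T : ℕ) : ℝ :=
  if σ = 0 then 1 / (2 * L) else min (1 / (2 * L)) (D / ((T : ℝ) ^ (3 / 2 : ℝ) * σ * τ ^ (1 / 2 : ℝ)))

theorem stepScale_mul_le {L D σ τ : ℝ} (hL : 0 < L) (T : ℕ) :
    stepScale L D σ τ T * (2 * L) ≤ 1 := by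
  have h1 : stepScale L D σ τ T ≤ 1 / (2 * L) := by
    unfold stepScale
    split_ifs
    · exact le_rfl
    · exact min_le_left _ _
  rwa [← le_div_iff₀ (by positivity)]

theorem stepScale_pos {L D σ τ : ℝ} (hL : 0 < L) (hD : 0 < D) (hσ : 0 ≤ σ) (hτ : 0 < τ) {T : ℕ}
    (hT : 1 ≤ T) : 0 < stepScale L D σ τ T := by
  have hT0 : (0 : ℝ) < T := by exact_mod_cast hT
  unfold stepScale
  split_ifs with h
  · positivity
  · have : 0 < σ := lt_of_le_of_ne hσ (Ne.symm h)
    positivity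

/-- Optimizing the free parameter in the convergence guarantee. -/
theorem gap_le_of_forall {L D σ τ κ G l : ℝ} (hL : 0 < L) (hD : 0 < D) (hσ : 0 ≤ σ) (hτ : 1 ≤ τ)
    (hκ : 1 ≤ κ) (hl : 0 ≤ l) {T : ℕ} (hT : 1 ≤ T)
    (h : ∀ s : ℝ, 0 < s → stepScale L D σ τ T * (T : ℝ) ^ 2 / 4 * G
      ≤ D ^ 2 + stepScale L D σ τ T ^ 2 * (T : ℝ) ^ 3 * (6 * σ ^ 2 * τ * κ * (1 + 5 * l))
        + stepScale L D σ τ T * (T : ℝ) ^ 2 * (2 * s * σ ^ 2 * τ * κ / T + D ^ 2 / s)) :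
    G ≤ 12 * (L * D ^ 2 / (T : ℝ) ^ 2)
      + 120 * κ * (1 + l) * (D * σ * Real.sqrt τ / Real.sqrt T) := by
  have hT0 : (0 : ℝ) < T := by exact_mod_cast hT
  have hτ0 : 0 < τ := by linarith
  have hg := stepScale_pos hL hD hσ hτ0 hT
  set g := stepScale L D σ τ T with hgdef
  have hG : ∀ s : ℝ, 0 < s → G ≤ 4 * D ^ 2 / (T : ℝ) ^ 2 * g⁻¹
      + g * (4 * T * (6 * σ ^ 2 * τ * κ * (1 + 5 * l)))
      + 4 * (2 * s * σ ^ 2 * τ * κ / T + D ^ 2 / s) := by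
    intro s hs
    have h1 := h s hs
    have h2 : 0 < g * (T : ℝ) ^ 2 / 4 := by positivity
    rw [← le_div_iff₀' h2] at h1
    refine h1.trans (le_of_eq ?_)
    field_simp
  by_cases h0 : σ = 0
  · have hg2 : g⁻¹ = 2 * L := by rw [hgdef, stepScale, if_pos h0, one_div, inv_inv]
    -- Without noise any large s would do; this one makes the last term 4LD²/T², which with 8LD²/T²
    -- from g⁻¹ = 2L gives 12.
    have h1 := hG ((T : ℝ) ^ 2 / L) (by positivity)
    rw [hg2, h0] at h1
    rw [h0]
    refine h1.trans (le_of_eq ?_)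
    field_simp
    ring
  · have hσ0 : 0 < σ := lt_of_le_of_ne hσ (Ne.symm h0)
    set a := Real.sqrt τ with ha
    set b := Real.sqrt T with hb
    have ha0 : 0 < a := Real.sqrt_pos.2 hτ0
    have hb0 : 0 < b := Real.sqrt_pos.2 hT0
    have ha2 : τ = a ^ 2 := (Real.sq_sqrt hτ0.le).symm
    have hb2 : (T : ℝ) = b ^ 2 := (Real.sq_sqrt hT0.le).symm
    have hb3 : (T : ℝ) ^ (3 / 2 : ℝ) = b ^ 3 := by
      rw [hb, Real.sqrt_eq_rpow, ← Real.rpow_natCast, ← Real.rpow_mul hT0.le]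
      norm_num
    have hgmin : g = min (1 / (2 * L)) (D / (b ^ 3 * σ * a)) := by
      rw [hgdef, stepScale, if_neg h0, hb3, ← Real.sqrt_eq_rpow]
    have hg1 : g ≤ D / (b ^ 3 * σ * a) := hgmin ▸ min_le_right _ _
    -- The inverse of a minimum of positive numbers is at most the sum of the inverses.
    have hg2 : g⁻¹ ≤ 2 * L + b ^ 3 * σ * a / D := by
      rw [hgmin]
      rcases min_choice (1 / (2 * L)) (D / (b ^ 3 * σ * a)) with h1 | h1
      · rw [h1, one_div, inv_inv]
        have : 0 ≤ b ^ 3 * σ * a / D := by positivity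
        linarith
      · rw [h1, inv_div]
        linarith
    -- The choice s = D√T/(σ√τ) balances sσ²τ/T against D²/s; both become Dσ√τ/√T.
    have h1 := hG (D * b / (σ * a)) (by positivity)
    rw [ha2, hb2] at h1
    have h2 : 4 * D ^ 2 / (b ^ 2) ^ 2 * g⁻¹
        ≤ 8 * (L * D ^ 2 / (b ^ 2) ^ 2) + 4 * (D * σ * a / b) := by
      refine (mul_le_mul_of_nonneg_left hg2 (by positivity)).trans (le_of_eq ?_)
      field_simp
      ring
    have h3 : g * (4 * b ^ 2 * (6 * σ ^ 2 * a ^ 2 * κ * (1 + 5 * l)))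
        ≤ 24 * κ * (1 + 5 * l) * (D * σ * a / b) := by
      refine (mul_le_mul_of_nonneg_right hg1 (by positivity)).trans (le_of_eq ?_)
      field_simp
      ring
    have h4 : 4 * (2 * (D * b / (σ * a)) * σ ^ 2 * a ^ 2 * κ / b ^ 2 + D ^ 2 / (D * b / (σ * a)))
        = (8 * κ + 4) * (D * σ * a / b) := by
      field_simp
      ring
    rw [h4] at h1
    rw [hb2]
    have hq : 0 ≤ D * σ * a / b := by positivity
    have h5 : 0 ≤ L * D ^ 2 / (b ^ 2) ^ 2 := by positivity
    have h6 : (4 + 24 * κ * (1 + 5 * l) + (8 * κ + 4)) * (D * σ * a / b)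
        ≤ 120 * κ * (1 + l) * (D * σ * a / b) := by
      refine mul_le_mul_of_nonneg_right ?_ hq
      nlinarith
    linarith

/-- The number of iterations beats the logarithmic factors. -/
theorem rate_le_of_le {K T A N κ : ℝ} (hK : 0 < K) (hT : 1 ≤ T) (hA : 1 ≤ A) (hκ : 1 ≤ κ)
    (hN : N = 2400 * κ) (h : N ^ 4 * A ^ 3 * (1 + Real.log (1 + K)) ^ 2 * K ≤ T) :
    12 * (K ^ 2 / T ^ 2) ≤ 1 / 2 ∧
      240 * κ * (1 + Real.log T) * (Real.sqrt K / Real.sqrt T) ≤ 1 / 2 := by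
  have hT0 : 0 < T := by linarith
  have hN1 : 2400 ≤ N := by rw [hN]; linarith
  set l := 1 + Real.log (1 + K) with hl
  have hlogK : 0 ≤ Real.log (1 + K) := Real.log_nonneg (by linarith)
  have hl1 : 1 ≤ l := by linarith
  set R := T / K with hR
  have hR0 : 0 < R := by positivity
  have hRl : N ^ 4 * l ^ 2 ≤ R := by
    rw [hR, le_div_iff₀ hK]
    refine le_trans ?_ h
    have : (1 : ℝ) ≤ A ^ 3 := one_le_pow₀ hA
    gcongr
    exact le_mul_of_one_le_right (by positivity) this
  -- With y = R^{1/4}, log R = 4 log y ≤ 4y is absorbed by √R = y², since y ≥ N. This is why the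
  -- threshold carries N⁴, while the square on 1 + log(1 + K) handles log K.
  set y := Real.sqrt (Real.sqrt R) with hy
  have hy0 : 0 < y := Real.sqrt_pos.2 (Real.sqrt_pos.2 hR0)
  have hy2 : y ^ 2 = Real.sqrt R := Real.sq_sqrt (Real.sqrt_nonneg _)
  have hy4 : y ^ 4 = R := by
    rw [show y ^ 4 = (y ^ 2) ^ 2 by ring, hy2, Real.sq_sqrt hR0.le]
  have hyl : N ^ 2 * l ≤ y ^ 2 := by
    refine le_of_sq_le_sq ?_ (by positivity)
    nlinarith
  have hyN : N ≤ y := by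
    refine le_of_sq_le_sq ?_ hy0.le
    nlinarith [sq_nonneg N]
  constructor
  · have h1 : K ^ 2 / T ^ 2 = (R ^ 2)⁻¹ := by rw [hR, div_pow, inv_div]
    have h2 : 24 ≤ R := by
      rw [← hy4]
      have : (2400 : ℝ) ≤ y := hN1.trans hyN
      nlinarith [pow_le_pow_left₀ (by norm_num) this 4]
    rw [h1]
    have h3 : (R ^ 2)⁻¹ ≤ (24 : ℝ)⁻¹ := by
      gcongr
      nlinarith
    linarith
  · have h1 : Real.sqrt K / Real.sqrt T = (y ^ 2)⁻¹ := by
      rw [hy2, hR, Real.sqrt_div hT0.le, inv_div]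
    have h2 : Real.log T = Real.log R + Real.log K := by
      rw [← Real.log_mul hR0.ne' hK.ne', hR, div_mul_cancel₀ _ hK.ne']
    have h3 : Real.log K ≤ Real.log (1 + K) := Real.log_le_log hK (by linarith)
    have h4 : Real.log R ≤ 4 * y := by
      rw [← hy4, Real.log_pow]
      have := Real.log_le_sub_one_of_pos hy0
      push_cast
      linarith
    have h5 : 1 + Real.log T ≤ l + 4 * y := by linarith
    rw [h1, ← div_eq_mul_inv, div_le_iff₀ (by positivity)]
    have h6 : 240 * κ = N / 10 := by rw [hN]; ring
    rw [h6]
    have h7 : N / 10 * (1 + Real.log T) ≤ N / 10 * (l + 4 * y) :=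
      mul_le_mul_of_nonneg_left h5 (by positivity)
    have h8 : N * y ≤ y ^ 2 := by nlinarith
    have h9 : N * l ≤ y ^ 2 / 2400 := by
      rw [le_div_iff₀ (by norm_num)]
      nlinarith [mul_nonneg (by linarith : (0 : ℝ) ≤ N) (by linarith : (0 : ℝ) ≤ l)]
    nlinarith

theorem complexity_nonneg (L D σ τ ε : ℝ) : 0 ≤ complexity L D σ τ ε :=
  le_max_of_le_left (Real.sqrt_nonneg _)

/-- By definition of K, LD² ≤ εK² and Dσ√τ ≤ ε√K, so the two terms of the rate are ε times K²/T² and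
√(K/T) up to constants and logarithms; each is at most ε/2. -/
theorem gap_le_of_complexity_le {L D σ τ κ G ε A N : ℝ} (hL : 0 < L) (hD : 0 < D) (hσ : 0 ≤ σ)
    (hτ : 1 ≤ τ) (hκ : 1 ≤ κ) (hε : 0 < ε) (hA : 1 ≤ A) (hN : N = 2400 * κ) {T : ℕ} (hT : 1 ≤ T)
    (h : N ^ 4 * A ^ 3 * (1 + Real.log (1 + complexity L D σ τ ε)) ^ 2
      * complexity L D σ τ ε ≤ T)
    (hG : G ≤ 12 * (L * D ^ 2 / (T : ℝ) ^ 2)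
      + 120 * κ * (1 + Nat.log 2 T) * (D * σ * Real.sqrt τ / Real.sqrt T)) : G ≤ ε := by
  set K := complexity L D σ τ ε with hK
  have hτ0 : 0 < τ := by linarith
  have hT1 : (1 : ℝ) ≤ T := by exact_mod_cast hT
  have hT0 : (0 : ℝ) < T := by linarith
  have h1 : Real.sqrt (L * D ^ 2 / ε) ≤ K := le_max_left _ _
  have h2 : τ * D ^ 2 * σ ^ 2 / ε ^ 2 ≤ K := le_max_right _ _
  have hK0 : 0 < K := lt_of_lt_of_le (Real.sqrt_pos.2 (by positivity)) h1
  obtain ⟨h3, h4⟩ := rate_le_of_le hK0 hT1 hA hκ hN h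
  have h5 : L * D ^ 2 ≤ ε * K ^ 2 := by
    have := (Real.sqrt_le_left hK0.le).1 h1
    rwa [div_le_iff₀' hε] at this
  have h6 : D * σ * Real.sqrt τ ≤ ε * Real.sqrt K := by
    have h7 : τ * D ^ 2 * σ ^ 2 ≤ ε ^ 2 * K := by rwa [div_le_iff₀' (by positivity)] at h2
    refine le_of_sq_le_sq ?_ (by positivity)
    rw [mul_pow, mul_pow, mul_pow, Real.sq_sqrt hτ0.le, Real.sq_sqrt hK0.le]
    linarith
  have h7 : 12 * (L * D ^ 2 / (T : ℝ) ^ 2) ≤ ε * (12 * (K ^ 2 / (T : ℝ) ^ 2)) := by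
    have : L * D ^ 2 / (T : ℝ) ^ 2 ≤ ε * K ^ 2 / (T : ℝ) ^ 2 := by gcongr
    linarith [show ε * (12 * (K ^ 2 / (T : ℝ) ^ 2)) = 12 * (ε * K ^ 2 / (T : ℝ) ^ 2) by ring]
  have h8 : 120 * κ * (1 + Nat.log 2 T) * (D * σ * Real.sqrt τ / Real.sqrt T)
      ≤ ε * (240 * κ * (1 + Real.log T) * (Real.sqrt K / Real.sqrt T)) := by
    have h9 : D * σ * Real.sqrt τ / Real.sqrt T ≤ ε * (Real.sqrt K / Real.sqrt T) := by
      rw [← mul_div_assoc]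
      gcongr
    have h10 : 120 * κ * (1 + (Nat.log 2 T : ℝ)) ≤ 240 * κ * (1 + Real.log T) := by
      nlinarith [natLog_two_le hT]
    calc 120 * κ * (1 + Nat.log 2 T) * (D * σ * Real.sqrt τ / Real.sqrt T)
        ≤ 240 * κ * (1 + Real.log T) * (ε * (Real.sqrt K / Real.sqrt T)) :=
          mul_le_mul h10 h9 (by positivity) (le_trans (by positivity) h10)
      _ = _ := by ring
  nlinarith

/-- T is at most a polynomial in A, l and max(1, K), so log T is linear in A and l by log x ≤ x - 1,
where log max(1, K) ≤ l - 1. One further factor A l therefore suffices. -/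
theorem mul_one_add_natLog_le {C A K : ℝ} (hC : 0 < C) (hA : 1 ≤ A) (hK : 0 ≤ K) {T : ℕ}
    (hT : T = max 1 ⌈C * A ^ 3 * (1 + Real.log (1 + K)) ^ 2 * K⌉₊) :
    (T : ℝ) * (1 + Nat.log 2 T)
      ≤ 2 * (1 + C) * (8 + C) * A ^ 4 * (1 + Real.log (1 + K)) ^ 3 * max 1 K := by
  set l := 1 + Real.log (1 + K) with hl
  set m := max 1 K with hm
  have hlogK : 0 ≤ Real.log (1 + K) := Real.log_nonneg (by linarith)
  have hl1 : 1 ≤ l := by linarith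
  have hm1 : 1 ≤ m := le_max_left _ _
  have hT1 : 1 ≤ T := hT ▸ le_max_left _ _
  have hT0 : (0 : ℝ) < T := by exact_mod_cast hT1
  have hAl : 1 ≤ A ^ 3 * l ^ 2 := one_le_mul_of_one_le_of_one_le (one_le_pow₀ hA) (one_le_pow₀ hl1)
  have hTle : (T : ℝ) ≤ (1 + C) * A ^ 3 * l ^ 2 * m := by
    have hx : 0 ≤ C * A ^ 3 * l ^ 2 * K := by positivity
    have h1 : (T : ℝ) ≤ 1 + C * A ^ 3 * l ^ 2 * K := by
      rw [hT, Nat.cast_max, Nat.cast_one]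
      exact max_le (by linarith) (by linarith [(Nat.ceil_lt_add_one hx).le])
    have h2 : C * A ^ 3 * l ^ 2 * K ≤ C * A ^ 3 * l ^ 2 * m := by
      gcongr
      exact le_max_right _ _
    have h3 : 1 ≤ A ^ 3 * l ^ 2 * m := one_le_mul_of_one_le_of_one_le hAl hm1
    linarith
  have hlogT : Real.log T ≤ C + 3 * A + 3 * l := by
    have h1 := Real.log_le_log hT0 hTle
    rw [Real.log_mul (by positivity) (by positivity), Real.log_mul (by positivity) (by positivity),
      Real.log_mul (by positivity) (by positivity), Real.log_pow, Real.log_pow] at h1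
    have h2 := Real.log_le_sub_one_of_pos (by linarith : 0 < 1 + C)
    have h3 := Real.log_le_sub_one_of_pos (by linarith : 0 < A)
    have h4 := Real.log_le_sub_one_of_pos (by linarith : 0 < l)
    have h5 : Real.log m ≤ Real.log (1 + K) :=
      Real.log_le_log (by positivity) (max_le (by linarith) (by linarith))
    push_cast at h1
    linarith
  have hAl' : 1 ≤ A * l := one_le_mul_of_one_le_of_one_le hA hl1
  have h6 : 1 + (Nat.log 2 T : ℝ) ≤ 2 * (8 + C) * (A * l) := by
    have h7 := natLog_two_le hT1
    have h8 : A ≤ A * l := le_mul_of_one_le_right (by linarith) hl1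
    have h9 : l ≤ A * l := le_mul_of_one_le_left (by linarith) hA
    nlinarith
  calc (T : ℝ) * (1 + Nat.log 2 T)
      ≤ ((1 + C) * A ^ 3 * l ^ 2 * m) * (2 * (8 + C) * (A * l)) :=
        mul_le_mul hTle h6 (by positivity) (by positivity)
    _ = _ := by ring

/-- An iteration costs at most one call plus 2^J on the event 2^J ≤ M, and the latter has
expectation ⌊log₂ M⌋. -/
theorem IsIIDGeometricHalf.integral_oracleCalls_le {Ω : Type*} [MeasurableSpace Ω] {μ : Measure Ω}
    [IsProbabilityMeasure μ] {J : ℕ → Ω → ℕ} (hJ : IsIIDGeometricHalf μ J) {M : ℕ} (hM : 1 ≤ M)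
    (T : ℕ) : Integrable (fun a => (oracleCalls M 1 (fun t => J t a) T : ℝ)) μ ∧
      ∫ a, (oracleCalls M 1 (fun t => J t a) T : ℝ) ∂μ ≤ T * (1 + Nat.log 2 M) := by
  have h1 : ∀ t, Integrable (fun a => ((if 2 ^ J t a ≤ M then 2 ^ J t a * 1 else 1 : ℕ) : ℝ)) μ ∧
      ∫ a, ((if 2 ^ J t a ≤ M then 2 ^ J t a * 1 else 1 : ℕ) : ℝ) ∂μ ≤ 1 + Nat.log 2 M := by
    intro t
    obtain ⟨hi, he⟩ := hJ.integral_ite_two_pow t hM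
    have hle : ∀ a, ((if 2 ^ J t a ≤ M then 2 ^ J t a * 1 else 1 : ℕ) : ℝ)
        ≤ 1 + if 2 ^ J t a ≤ M then (2 : ℝ) ^ J t a else 0 := by
      intro a
      split_ifs <;> simp
    have hm : Measurable fun a => ((if 2 ^ J t a ≤ M then 2 ^ J t a * 1 else 1 : ℕ) : ℝ) :=
      measurable_comp_nat (hJ.measurable t)
        (g := fun n _ => ((if 2 ^ n ≤ M then 2 ^ n * 1 else 1 : ℕ) : ℝ)) fun n => measurable_const
    have hbound : Integrable (fun a => 1 + if 2 ^ J t a ≤ M then (2 : ℝ) ^ J t a else 0) μ :=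
      (integrable_const _).add hi
    have hint := hbound.mono' hm.aestronglyMeasurable (ae_of_all _ fun a => by
      rw [Real.norm_of_nonneg (Nat.cast_nonneg _)]; exact hle a)
    refine ⟨hint, (integral_mono hint hbound hle).trans ?_⟩
    rw [integral_add (integrable_const _) hi, he]
    simp
  unfold oracleCalls
  simp only [Nat.cast_sum]
  refine ⟨integrable_finsetSum _ fun t _ => (h1 t).1, ?_⟩
  rw [integral_finsetSum _ fun t _ => (h1 t).1]
  refine (Finset.sum_le_card_nsmul _ _ _ fun t _ => (h1 t).2).trans (le_of_eq ?_)
  rw [Finset.card_range, nsmul_eq_mul]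

end Rates

end MAMD

end

/-! ### Assembly of the iteration and oracle bounds -/

theorem corollary2 :
    ∀ C₀ : ℝ, ∃ C₁ > (0 : ℝ), ∃ C₂ > (0 : ℝ),
      ∀ (d : ℕ) (p : ℝ≥0∞) [Fact (1 ≤ p)] (_ : p ≤ 2)
        -- the noise
        (S : Type*) [TopologicalSpace S] [PolishSpace S] [MeasurableSpace S] [BorelSpace S]
        (Ω : Type*) [MeasurableSpace Ω] (μ : Measure Ω) [IsProbabilityMeasure μ]
        (P : Kernel S S) [IsMarkovKernel P] (π : Measure S) [IsProbabilityMeasure π]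
        (τ : ℝ) (_ : 1 ≤ τ) (_ : MAMD.IsUniformlyErgodic P π C₀ τ)
        (Z : ℕ → Ω → S) (_ : MAMD.IsMarkovChain μ P Z)
        (J : ℕ → Ω → ℕ) (_ : MAMD.IsIIDGeometricHalf μ J)
        (_ : IndepFun (fun ω t => Z t ω) (fun ω t => J t ω) μ)
        -- the feasible set and the Bregman divergence
        (X : Set (PiLp p fun _ : Fin d => ℝ)) (_ : IsCompact X) (_ : Convex ℝ X)
        (ω : (PiLp p fun _ : Fin d => ℝ) → ℝ)
        (ω' : (PiLp p fun _ : Fin d => ℝ) → (PiLp p fun _ : Fin d => ℝ) →L[ℝ] ℝ)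
        (_ : MAMD.IsDistanceGenerating X ω ω')
        (D : ℝ) (_ : 0 ≤ D)
        (_ : IsGreatest {v | ∃ x ∈ X, ∃ y ∈ X, v = MAMD.bregman ω ω' x y} (D ^ 2))
        -- the objective and its oracle
        (F : (PiLp p fun _ : Fin d => ℝ) → S → ℝ) (_ : Measurable (Function.uncurry F))
        (L : ℝ) (_ : 0 < L) (_ : MAMD.IsSmoothOn X L (MAMD.objective π F))
        (_ : ConvexOn ℝ X (MAMD.objective π F))
        (σ : ℝ) (_ : 0 ≤ σ) (_ : MAMD.IsBoundedNoiseOracle X π F σ)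
        -- the starting point and the accuracy
        (x₀ : PiLp p fun _ : Fin d => ℝ) (_ : x₀ ∈ X) (ε : ℝ) (_ : 0 < ε),
        -- iteration complexity
        (∀ T : ℕ, 1 ≤ T →
          C₁ * (1 + Real.log d) ^ 3 * (1 + Real.log (1 + MAMD.complexity L D σ τ ε)) ^ 2
              * MAMD.complexity L D σ τ ε ≤ T →
          Integrable (fun a => MAMD.objective π F
            (MAMD.output X ω ω' F L D σ τ x₀ (fun t => Z t a) (fun t => J t a) T)) μ ∧
          ∫ a, (MAMD.objective π F
              (MAMD.output X ω ω' F L D σ τ x₀ (fun t => Z t a) (fun t => J t a) T)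
            - sInf (MAMD.objective π F '' X)) ∂μ ≤ ε) ∧
        -- oracle complexity, for the least such number of iterations
        (∀ T : ℕ,
          T = max 1 ⌈C₁ * (1 + Real.log d) ^ 3
            * (1 + Real.log (1 + MAMD.complexity L D σ τ ε)) ^ 2
            * MAMD.complexity L D σ τ ε⌉₊ →
          Integrable (fun a => (MAMD.oracleCalls T 1 (fun t => J t a) T : ℝ)) μ ∧
          ∫ a, (MAMD.oracleCalls T 1 (fun t => J t a) T : ℝ) ∂μ ≤
            C₂ * (1 + Real.log d) ^ 4
              * (1 + Real.log (1 + MAMD.complexity L D σ τ ε)) ^ 3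
              * max 1 (MAMD.complexity L D σ τ ε)) := by

  intro C₀
  set κ : ℝ := 1 + 4 * |C₀| with hκ
  have hκ1 : 1 ≤ κ := by linarith [abs_nonneg C₀]
  -- This is N⁴ for the N = 2400κ of `rate_le_of_le`.
  set C₁ : ℝ := (2400 * κ) ^ 4 with hC₁
  have hC₁0 : 0 < C₁ := by positivity
  refine ⟨C₁, hC₁0, 2 * (1 + C₁) * (8 + C₁), by positivity, ?_⟩
  intro d p _ _ S _ _ _ _ Ω _ μ _ P _ π _ τ hτ hP Z hZ J hJ hZJ X hXc _ ω ω' hω D hD hmax F hFm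
    L hL hf hconv σ hσ hF x₀ hx₀ ε hε
  -- This also covers d = 0, as `Real.log 0 = 0`.
  have hA : 1 ≤ 1 + Real.log d := by linarith [Real.log_natCast_nonneg d]
  have h : MAMD.IsMarkovianProblem μ P π C₀ τ Z J X ω ω' D F L σ :=
    ⟨hτ, hP, hZ, hJ, hZJ, hXc, hω, hD, fun x hx y hy => hmax.2 ⟨x, hx, y, hy, rfl⟩, hFm, hL, hf,
      hconv, hσ, hF⟩
  refine ⟨fun T hT hTC => ?_, fun T hT => ?_⟩
  · have hγ : ∀ t, MAMD.stepsize L D σ τ T t = MAMD.momentum t * MAMD.stepScale L D σ τ T :=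
      fun t => rfl
    have hint := h.integrable_objective_xf (M := T) hx₀ (MAMD.stepsize L D σ τ T) T
    refine ⟨hint, ?_⟩
    have hc : ContinuousOn (MAMD.objective π F) X := fun x hx =>
      (hf.1 x hx).continuousAt.continuousWithinAt
    obtain ⟨u, hu, hmin⟩ := hXc.exists_isMinOn ⟨x₀, hx₀⟩ hc
    have hsInf : sInf (MAMD.objective π F '' X) = MAMD.objective π F u :=
      IsLeast.csInf_eq ⟨Set.mem_image_of_mem _ hu, by rintro _ ⟨y, hy, rfl⟩; exact hmin hy⟩
    rw [hsInf]
    -- For D = 0 strong convexity forces X to be a single point, so the output is the minimiser; the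
    -- rate estimates need D > 0 because the step scale may vanish otherwise.
    rcases hD.eq_or_lt with hD0 | hD0
    · have heq : ∀ a, MAMD.output X ω ω' F L D σ τ x₀ (fun t => Z t a) (fun t => J t a) T = u := by
        intro a
        have h1 := h.norm_sub_le (MAMD.run_mem (F := F) (γ := MAMD.stepsize L D σ τ T) (M := T) hω hXc
          MAMD.one_le_momentum hx₀ (fun t => Z t a) (fun t => J t a) T).2 hu
        rw [← hD0, mul_zero, norm_le_zero_iff, sub_eq_zero] at h1
        rwa [← hD0]
      simp [heq, hε.le]
    · refine MAMD.gap_le_of_complexity_le hL hD0 hσ hτ hκ1 hε hA rfl hT hTC ?_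
      exact MAMD.gap_le_of_forall hL hD0 hσ hτ hκ1 (Nat.cast_nonneg _) hT fun s hs =>
        h.integral_gap_le hx₀ (MAMD.stepScale_pos hL hD0 hσ (by linarith) hT).le
          (MAMD.stepScale_mul_le hL T) hu (fun y hy => hmin hy) hT hγ hs
  · have hT1 : 1 ≤ T := hT ▸ le_max_left _ _
    obtain ⟨h1, h2⟩ := hJ.integral_oracleCalls_le hT1 T
    exact ⟨h1, h2.trans (MAMD.mul_one_add_natLog_le hC₁0 hA (MAMD.complexity_nonneg _ _ _ _ _) hT)⟩
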